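/- Let $m,d\ge 1$ be integers and $\mathbb K\in\{\mathbb R,\mathbb C\}$. Put $r=\binom{m+d}{m}-1$, let $\nu_d:\mathbb P^m(\mathbb K)\to\mathbb P^r(\mathbb K)$ be the order $d$ Veronese embedding, and let $X_{m,d}(\mathbb K)=\nu_d(\mathbb P^m(\mathbb K))$. For $b\ge 1$ let $\sigma_b(X_{m,d}(\mathbb C))\subseteq\mathbb P^r(\mathbb C)$ be the closure of the union of the linear spans $\langle S\rangle$ of all sets $S\subset X_{m,d}(\mathbb C)$ with $\sharp(S)\le b$, and let $\sigma_b(X_{m,d}(\mathbb C))(\mathbb R)=\sigma_b(X_{m,d}(\mathbb C))\cap\mathbb P^r(\mathbb R)$ be its set of real points, with the Euclidean topology. The real rank of $P\in\mathbb P^r(\mathbb R)$ is the minimal cardinality of a set $S\subset X_{m,d}(\mathbb R)$ such that $P\in\langle S\rangle$. An integer $\rho$ is called a typical rank of $\sigma_b(X_{m,d}(\mathbb C))(\mathbb R)$ if there is a non-empty connected open subset $U$ of $\sigma_b(X_{m,d}(\mathbb C))(\mathbb R)$ that is a (smooth, embedded) manifold of dimension $b(m+1)-1$ and all of whose points have real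 rank $\rho$. Theorem. Let $m\ge 4$ and $d\ge 10$ be integers. Then the set of typical ranks of $\sigma_5(X_{m,d}(\mathbb C))(\mathbb R)$ is exactly $\{5,\ d+3,\ 2d+1\}$. -/

import Mathlib

open scoped ContDiff

/-- The ambient space `K^(r+1)`, `r + 1 = (m+d choose d)`, of the `d`-th Veronese embedding of
`ℙ^m(K)`: its coordinates are indexed by the degree `d` monomials in `x_0, …, x_m`, that is, by
the multisets of size `d` of elements of `{0, …, m}`. -/
abbrev VeroneseSpace (K : Type) (m d : ℕ) : Type := Sym (Fin (m + 1)) d → K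

/-- The Veronese embedding `ν_d` in homogeneous coordinates: the vector of all the degree `d`
monomials evaluated at `x`. -/
def veronese {K : Type} [Field K] (m d : ℕ) (x : Fin (m + 1) → K) : VeroneseSpace K m d :=
  fun s => ((s : Multiset (Fin (m + 1))).map x).prod

/-- `p` lies in the linear span of (at most) `k` points of the Veronese variety `X_{m,d}(K)`. -/
def InSpanOfPoints {K : Type} [Field K] (m d k : ℕ) (p : VeroneseSpace K m d) : Prop :=
  ∃ x : Fin k → Fin (m + 1) → K,
    p ∈ Submodule.span K (Set.range fun i => veronese m d (x i))

/-- `r` is the rank over `K` of `p` with respect to `X_{m,d}(K)`: the least number of points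
of `X_{m,d}(K)` whose linear span contains `p`. -/
def HasRank {K : Type} [Field K] (m d : ℕ) (p : VeroneseSpace K m d) (r : ℕ) : Prop :=
  IsLeast {k : ℕ | InSpanOfPoints m d k p} r

/-- The affine cone over the secant variety `σ_b(X_{m,d}(ℂ))`: the closure of the union of the
linear spans of `b` points of `X_{m,d}(ℂ)`.  (This union is constructible, so its
Euclidean closure, taken here, is also its Zariski closure.) -/
def secantCone (m d b : ℕ) : Set (VeroneseSpace ℂ m d) :=
  closure {p | InSpanOfPoints m d b p}

/-- The real points `σ_b(X_{m,d}(ℂ))(ℝ)`, given by their nonzero real homogeneous coordinate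
vectors. -/
def realSecantCone (m d b : ℕ) : Set (VeroneseSpace ℝ m d) :=
  {p | p ≠ 0 ∧ (fun s => (p s : ℂ)) ∈ secantCone m d b}

/-- `U` is a (smooth, embedded) submanifold of dimension `n` of the normed space `E`: near each of
its points it is the homeomorphic image of an open subset of `ℝ^n` under a smooth immersion. -/
def IsSubmanifoldOfDim {E : Type} [NormedAddCommGroup E] [NormedSpace ℝ E] (n : ℕ)
    (U : Set E) : Prop :=
  ∀ p ∈ U, ∃ W : Set E, IsOpen W ∧ p ∈ W ∧
    ∃ (Ω : Set (EuclideanSpace ℝ (Fin n))) (φ : EuclideanSpace ℝ (Fin n) → E),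
      IsOpen Ω ∧ ContDiffOn ℝ ∞ φ Ω ∧ (∀ t ∈ Ω, Function.Injective (fderiv ℝ φ t)) ∧
        Topology.IsEmbedding (fun t : Ω => φ t) ∧ φ '' Ω = U ∩ W

/-- `r` is a typical rank of `σ_b(X_{m,d}(ℂ))(ℝ)`: there is a nonempty connected open subset `U`
of the real locus (for the Euclidean topology), a manifold of dimension `b(m+1) - 1`, at all of
whose points the real rank is `r`.  Points are represented by coordinate vectors, so that the
dimension of `U` is raised by one, to `b(m+1)`. -/
def IsTypicalRank (m d b r : ℕ) : Prop :=
  ∃ U : Set (VeroneseSpace ℝ m d),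
    IsConnected U ∧
    (∃ O : Set (VeroneseSpace ℝ m d), IsOpen O ∧ U = realSecantCone m d b ∩ O) ∧
    IsSubmanifoldOfDim (b * (m + 1)) U ∧
    ∀ p ∈ U, HasRank m d p r

/-! A general point of the cone over the secant variety is a sum of five Veronese vectors of
independent `x k`, and for `d` this large the `x k` are unique up to order and `d`-th roots of
unity. If the point is real, conjugation permutes the five projective points and fixes 5, 3 or 1 of
them; this number determines the real rank.

Upper bounds: a conjugate pair contributes `veroneseRe`, in effect a real binary form of degree `d`,
which is a combination of `d` real powers (`inSpanOfPoints_veroneseRe`); so one pair costs `d`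
points, and each real point costs one.

Lower bounds: let the point also be a combination of real `y i`. A product of `d` linear forms is a
functional on the Veronese space, so some `x k` has coefficient zero if such a product is nonzero
there and vanishes at all the other points (`coeff_eq_zero_of_separates`). As `x 0` is not real, one
form nonzero at `x 0` kills two real points as soon as one of them is off `conjLine (x 0)`. Hence,
if there are few `y i`, at least `d` of them lie on that line. With one pair and at most `d + 2`
points, the line and the two or fewer others cannot span five dimensions. With two pairs and at most
`2 * d` points, all points lie on two disjoint lines, whose span misses `x 4`.

Passage to the secant variety: the polynomial `genericity`, built from a catalecticant, is nonzero
exactly at sums of suitably general points. Where it is nonzero, the presentations are locally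
bounded, so taking the closure adds nothing. A manifold of full dimension cannot lie in its zero
locus, by a transcendence degree count (`exists_genericity_ne_zero`), so only the three ranks occur.
Conversely, each conjugation pattern gives a real parametrization which is an immersion, and open
onto the real locus (`image_realChart_mem_nhdsWithin`). -/

/-! ### Separating points by products of linear forms -/

/-- The linear forms on the Veronese space that restrict to products of `d` linear forms. -/
theorem exists_functional_veronese {m d : ℕ} (l : Fin d → Module.Dual ℂ (Fin (m + 1) → ℂ)) :
    ∃ Λ : VeroneseSpace ℂ m d →ₗ[ℂ] ℂ, ∀ x, Λ (veronese m d x) = ∏ t, l t x := by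
  -- Expand the product of the linear forms over all choices `f` of one variable per factor; each
  -- choice contributes the coordinate of its monomial.
  refine ⟨∑ f : Fin d → Fin (m + 1), (∏ t, l t (Pi.single (f t) 1)) •
    LinearMap.proj (⟨Finset.univ.val.map f, by simp⟩ : Sym (Fin (m + 1)) d), fun x => ?_⟩
  have h : ∀ t, l t x = ∑ i, x i * l t (Pi.single i 1) := fun t => by
    conv_lhs => rw [← Finset.univ_sum_single x]
    rw [map_sum]
    refine Finset.sum_congr rfl fun i _ => ?_
    rw [← smul_eq_mul, ← map_smul]
    congr 1
    ext j
    by_cases hj : j = i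
    · subst hj; simp
    · simp [hj]
  simp only [h, Finset.prod_univ_sum, LinearMap.sum_apply, Fintype.piFinset_univ]
  refine Finset.sum_congr rfl fun f _ => ?_
  rw [Finset.prod_mul_distrib, mul_comm]
  change (∏ t, l t (Pi.single (f t) 1)) * ((Finset.univ.val.map f).map x).prod = _
  rw [Multiset.map_map]
  rfl

/-- There are `D` linear forms, none vanishing at `x`, with product vanishing on `Z`. -/
def Separates {m : ℕ} (D : ℕ) (x : Fin (m + 1) → ℂ) (Z : Set (Fin (m + 1) → ℂ)) : Prop :=
  ∃ l : Fin D → Module.Dual ℂ (Fin (m + 1) → ℂ), (∀ t, l t x ≠ 0) ∧ ∀ z ∈ Z, ∃ t, l t z = 0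

namespace Separates

variable {m : ℕ} {x : Fin (m + 1) → ℂ} {Z Z' : Set (Fin (m + 1) → ℂ)} {D D' : ℕ}

theorem mono (h : Separates D x Z) (hZ : Z' ⊆ Z) : Separates D x Z' :=
  let ⟨l, h1, h2⟩ := h
  ⟨l, h1, fun z hz => h2 z (hZ hz)⟩

theorem union (h : Separates D x Z) (h' : Separates D' x Z') : Separates (D + D') x (Z ∪ Z') := by
  obtain ⟨l, h1, h2⟩ := h
  obtain ⟨l', h1', h2'⟩ := h'
  refine ⟨Fin.append l l', fun t => ?_, ?_⟩
  · induction t using Fin.addCases <;> simp [h1, h1']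
  · rintro z (hz | hz)
    · obtain ⟨t, ht⟩ := h2 z hz
      exact ⟨Fin.castAdd _ t, by simpa⟩
    · obtain ⟨t, ht⟩ := h2' z hz
      exact ⟨Fin.natAdd _ t, by simpa⟩

theorem of_notMem_span (h : x ∉ Submodule.span ℂ Z) : Separates 1 x Z := by
  obtain ⟨f, hf, hle⟩ := Submodule.exists_le_ker_of_notMem h
  exact ⟨fun _ => f, fun _ => hf, fun z hz => ⟨0, hle (Submodule.subset_span hz)⟩⟩

theorem empty (hx : x ≠ 0) (D : ℕ) : Separates D x ∅ := by
  obtain ⟨f, hf, -⟩ := Submodule.exists_le_ker_of_notMem (p := (⊥ : Submodule ℂ _)) (v := x)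
    (by simpa using hx)
  exact ⟨fun _ => f, fun _ => hf, by simp⟩

theorem mono_degree (h : Separates D x Z) (hx : x ≠ 0) (hD : D ≤ D') : Separates D' x Z := by
  obtain ⟨k, rfl⟩ := Nat.exists_eq_add_of_le hD
  exact (h.union (empty hx k)).mono (by simp)

/-- Points indexed by `JL` are killed one at a time, possibly together with one of those indexed
by `Jf`; the latter can be killed two at a time. -/
theorem of_pairs {ι : Type*} [DecidableEq ι] (y : ι → Fin (m + 1) → ℂ) (hx : x ≠ 0) (D : ℕ) :
    ∀ JL Jf : Finset ι, JL.card ≤ D → JL.card + Jf.card ≤ 2 * D →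
      (∀ i ∈ JL, x ∉ Submodule.span ℂ {y i}) →
      (∀ i ∈ Jf, ∀ j ∈ JL ∪ Jf, x ∉ Submodule.span ℂ {y i, y j}) →
      Separates D x (y '' (JL ∪ Jf : Finset ι)) := by
  induction D with
  | zero =>
    intro JL Jf h1 h2 _ _
    have h3 : JL = ∅ := by simpa using h1
    have h4 : Jf = ∅ := by simpa [h3] using h2
    subst h3 h4
    simpa using empty hx 0
  | succ D ih =>
    intro JL Jf h1 h2 h3 h4
    -- One form kills `A ∪ B` and the induction hypothesis handles the rest. The two counting
    -- conditions say that enough has been removed: a point of `JL` if `JL` is full, and two points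
    -- if the total is.
    have key : ∀ A ⊆ JL, ∀ B ⊆ Jf, JL.card ≤ D + A.card →
        JL.card + Jf.card ≤ 2 * D + A.card + B.card →
        x ∉ Submodule.span ℂ (y '' (A ∪ B : Finset ι)) →
        Separates (D + 1) x (y '' (JL ∪ Jf : Finset ι)) := by
      intro A hA B hB h5 h6 h7
      have cA := Finset.card_sdiff_add_card_eq_card hA
      have cB := Finset.card_sdiff_add_card_eq_card hB
      have := (ih (JL \ A) (Jf \ B) (by omega) (by omega)
        (fun i hi => h3 i (Finset.sdiff_subset hi))
        (fun i hi j hj => h4 i (Finset.sdiff_subset hi) j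
          (Finset.union_subset_union Finset.sdiff_subset Finset.sdiff_subset hj))).union
        (of_notMem_span h7)
      refine this.mono ?_
      rw [← Set.image_union]
      refine Set.image_mono fun i hi => ?_
      simp only [Finset.coe_union, Finset.coe_sdiff, Set.mem_union, Set.mem_sdiff,
        Finset.mem_coe] at hi ⊢
      tauto
    rcases JL.eq_empty_or_nonempty with rfl | ⟨i, hi⟩
    · rcases Jf.eq_empty_or_nonempty with rfl | ⟨j, hj⟩
      · simpa using empty hx _
      · by_cases hc : ∃ k ∈ Jf, k ≠ j
        · obtain ⟨k, hk, hkj⟩ := hc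
          refine key ∅ (by simp) {j, k} (by simp [Finset.insert_subset_iff, hj, hk]) (by simp) ?_ ?_
          · rw [Finset.card_pair hkj.symm]; simp at h2 ⊢; omega
          · have := h4 j hj k (by simp [hk])
            simpa [Set.image_pair] using this
        · push Not at hc
          have : Jf = {j} := by
            ext k; simp only [Finset.mem_singleton]; exact ⟨hc k, fun h => h ▸ hj⟩
          subst this
          refine key ∅ (by simp) {j} (by simp) (by simp) (by simp) ?_
          have := h4 j hj j (by simp)
          simpa using this
    · have hc : 0 < JL.card := Finset.card_pos.2 ⟨i, hi⟩
      rcases Jf.eq_empty_or_nonempty with rfl | ⟨j, hj⟩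
      · refine key {i} (by simpa) ∅ (by simp) (by simpa using h1) (by simp at h1 ⊢; omega) ?_
        simpa using h3 i hi
      · refine key {i} (by simpa) {j} (by simpa) (by simpa using h1) (by simp at h2 ⊢; omega) ?_
        have := h4 j hj i (by simp [hi])
        simpa [Set.image_pair, Set.pair_comm] using this

end Separates

theorem veronese_zero {K : Type} [Field K] {m d : ℕ} (hd : d ≠ 0) : veronese (K := K) m d 0 = 0 := by
  ext s
  simp [veronese, hd]

/-- If `x k₀` can be separated from the other points, it does not occur in a linear relation. -/
theorem coeff_eq_zero_of_separates {m d : ℕ} {ι κ : Type*} [Fintype ι] [Fintype κ]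
    {c : κ → ℂ} {x : κ → Fin (m + 1) → ℂ} {a : ι → ℂ} {y : ι → Fin (m + 1) → ℂ}
    (h : ∑ k, c k • veronese m d (x k) = ∑ j, a j • veronese m d (y j)) (k₀ : κ)
    (hs : Separates d (x k₀) (x '' {k | k ≠ k₀} ∪ Set.range y)) : c k₀ = 0 := by
  obtain ⟨l, h1, h2⟩ := hs
  obtain ⟨Λ, hΛ⟩ := exists_functional_veronese l
  have h3 := congrArg Λ h
  simp only [map_sum, map_smul, hΛ, smul_eq_mul] at h3
  rw [Finset.sum_eq_single k₀, Finset.sum_eq_zero] at h3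
  · exact (mul_eq_zero.1 h3).resolve_right (Finset.prod_ne_zero_iff.2 fun t _ => h1 t)
  · intro j _
    obtain ⟨t, ht⟩ := h2 (y j) (Or.inr ⟨j, rfl⟩)
    rw [Finset.prod_eq_zero (Finset.mem_univ t) ht, mul_zero]
  · intro k _ hk
    obtain ⟨t, ht⟩ := h2 (x k) (Or.inl ⟨k, hk, rfl⟩)
    rw [Finset.prod_eq_zero (Finset.mem_univ t) ht, mul_zero]
  · simp

open Submodule Module in
theorem finrank_lt_finrank_sup_span {m : ℕ} {W : Submodule ℂ (Fin (m + 1) → ℂ)}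
    {y : Fin (m + 1) → ℂ} (hy : y ∉ W) : finrank ℂ W < finrank ℂ ↥(W ⊔ span ℂ {y}) :=
  finrank_lt_finrank_of_lt (lt_of_le_of_ne le_sup_left fun h =>
    hy (h ▸ mem_sup_right (mem_span_singleton_self y)))

theorem star_mem_span {m : ℕ} {Z : Set (Fin (m + 1) → ℂ)}
    (hZ : ∀ z ∈ Z, star z ∈ Submodule.span ℂ Z) {x : Fin (m + 1) → ℂ}
    (hx : x ∈ Submodule.span ℂ Z) : star x ∈ Submodule.span ℂ Z := by
  induction hx using Submodule.span_induction with
  | mem z hz => exact hZ z hz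
  | zero => simp
  | add a b _ _ ha hb => rw [star_add]; exact add_mem ha hb
  | smul c a _ ha => rw [star_smul]; exact Submodule.smul_mem _ _ ha

/-- The (complexification of the real) line through `x` and its complex conjugate. -/
abbrev conjLine {m : ℕ} (x : Fin (m + 1) → ℂ) : Submodule ℂ (Fin (m + 1) → ℂ) :=
  Submodule.span ℂ {x, star x}

/-! ### Real points and the line of a conjugate pair -/

section ConjLine

open Submodule Module

variable {m : ℕ} {x : Fin (m + 1) → ℂ}

/-- A dimension count: if the span contained `x` it would contain `star x` too, hence all of `W`,
which is too large for `k` vectors. The following lemmas obtain the conjugation hypothesis from a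
span of conjugation-stable vectors, or from `star x` being among the vectors. -/
theorem notMem_span_range_of_card_lt {k : ℕ} (z : Fin k → Fin (m + 1) → ℂ)
    (hz : x ∈ span ℂ (Set.range z) → star x ∈ span ℂ (Set.range z))
    (W : Submodule ℂ (Fin (m + 1) → ℂ)) (hW : W ≤ conjLine x ⊔ span ℂ (Set.range z))
    (hk : k < finrank ℂ W) : x ∉ span ℂ (Set.range z) := by
  intro hx
  have h1 : conjLine x ≤ span ℂ (Set.range z) := by
    rw [span_le]
    rintro v (rfl | rfl)
    exacts [hx, hz hx]
  have h2 := finrank_mono (hW.trans (sup_le h1 le_rfl))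
  have h3 := finrank_range_le_card (R := ℂ) z
  rw [Set.finrank, Fintype.card_fin] at h3
  omega

theorem notMem_span_singleton (hx : finrank ℂ (conjLine x) = 2) {y : Fin (m + 1) → ℂ}
    (hy : star y = y) : x ∉ span ℂ {y} := by
  have := notMem_span_range_of_card_lt (x := x) ![y] (fun h => star_mem_span (by simp [hy]) h)
    (conjLine x) le_sup_left (by omega)
  simpa using this

theorem notMem_span_pair (hx : finrank ℂ (conjLine x) = 2) {y z : Fin (m + 1) → ℂ}
    (hy : star y = y) (hz : star z = z) (hyx : y ∉ conjLine x) : x ∉ span ℂ {y, z} := by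
  have h1 := finrank_lt_finrank_sup_span hyx
  have := notMem_span_range_of_card_lt (x := x) ![y, z] (fun h => star_mem_span (by
      simp only [Matrix.range_cons, Matrix.range_empty, Set.union_empty, Set.mem_union,
        Set.mem_singleton_iff, forall_eq_or_imp, forall_eq, hy, hz]
      exact ⟨subset_span (by simp), subset_span (by simp)⟩) h)
    (conjLine x ⊔ span ℂ {y}) (sup_le_sup_left (span_mono (by simp)) _) (by omega)
  simpa [Set.pair_comm] using this

theorem notMem_span_triple (hx : finrank ℂ (conjLine x) = 2) {y y' z : Fin (m + 1) → ℂ}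
    (hy : star y = y) (hy' : star y' = y') (hz : star z = z ∨ z = star x)
    (hyx : y ∉ conjLine x) (hyx' : y' ∉ conjLine x ⊔ span ℂ {y}) : x ∉ span ℂ {z, y, y'} := by
  have h1 := finrank_lt_finrank_sup_span hyx
  have h2 := finrank_lt_finrank_sup_span hyx'
  have hr : Set.range ![z, y, y'] = {z, y, y'} := by ext v; simp [Matrix.range_cons]; tauto
  have := notMem_span_range_of_card_lt (x := x) ![z, y, y'] (fun h => ?_)
    (conjLine x ⊔ span ℂ {y} ⊔ span ℂ {y'}) ?_ (by omega)
  · rwa [hr] at this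
  · rw [hr] at h ⊢
    rcases hz with hz | rfl
    · refine star_mem_span ?_ h
      rintro v (rfl | rfl | rfl)
      · rw [hz]; exact subset_span (by simp)
      · rw [hy]; exact subset_span (by simp)
      · rw [hy']; exact subset_span (by simp)
    · exact subset_span (by simp)
  · rw [hr, sup_assoc]
    exact sup_le_sup_left (sup_le (span_mono (by simp)) (span_mono (by simp))) _

/-- One may choose a point in `JL ∪ Jf`, in `JL` if possible. -/
theorem exists_pick {ι : Type*} [DecidableEq ι] (y : ι → Fin (m + 1) → ℂ)
    (hy : ∀ i, star (y i) = y i) (JL Jf : Finset ι) :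
    ∃ JL' ⊆ JL, ∃ Jf' ⊆ Jf, ∃ z, star z = z ∧
      y '' (JL ∪ Jf : Finset ι) ⊆ y '' (JL' ∪ Jf' : Finset ι) ∪ {z} ∧
      JL'.card ≤ JL.card - 1 ∧ JL'.card + Jf'.card ≤ JL.card + Jf.card - 1 := by
  rcases JL.eq_empty_or_nonempty with rfl | ⟨i, hi⟩
  · rcases Jf.eq_empty_or_nonempty with rfl | ⟨i, hi⟩
    · exact ⟨∅, by simp, ∅, by simp, 0, by simp, by simp, by simp, by simp⟩
    · refine ⟨∅, by simp, Jf.erase i, Finset.erase_subset _ _, y i, hy i, ?_, by simp, by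
        simp [Finset.card_erase_of_mem hi]⟩
      rintro _ ⟨j, hj, rfl⟩
      by_cases h : j = i
      · simp [h]
      · exact Or.inl ⟨j, by simpa [h] using hj, rfl⟩
  · have := Finset.card_pos.2 ⟨i, hi⟩
    refine ⟨JL.erase i, Finset.erase_subset _ _, Jf, subset_rfl, y i, hy i, ?_, by
        simp [Finset.card_erase_of_mem hi], by rw [Finset.card_erase_of_mem hi]; omega⟩
    rintro _ ⟨j, hj, rfl⟩
    by_cases h : j = i
    · simp [h]
    · exact Or.inl ⟨j, by simpa [h] using hj, rfl⟩

end ConjLine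

/-! ### Lower bounds for the number of real points -/

section LowerBounds

open Submodule Module

variable {m d : ℕ} {x : Fin 5 → Fin (m + 1) → ℂ}

theorem finrank_conjLine {k k' : Fin 5} (hx : LinearIndependent ℂ x) (hk : k ≠ k')
    (h : star (x k) = x k') : finrank ℂ (conjLine (x k)) = 2 := by
  have h1 : LinearIndependent ℂ ![x k, x k'] := by
    have := hx.comp ![k, k'] (by
      intro a b; fin_cases a <;> fin_cases b <;> simp [hk, hk.symm])
    convert this using 1
    ext i; fin_cases i <;> rfl
  have h2 := finrank_span_eq_card h1
  rw [conjLine, h]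
  have hr : Set.range ![x k, x k'] = {x k, x k'} := by ext v; simp [Matrix.range_cons]; tauto
  rw [hr, Fintype.card_fin] at h2
  exact h2

/-- Four vectors with conjugation-stable span cannot span `x 0`, since together with `x 1` they
would span five dimensions. One form thus kills three of the other `x k` and still has room for a
real point. -/
theorem notMem_span_rest (hx : LinearIndependent ℂ x) (h01 : star (x 0) = x 1)
    (hst : ∀ k, k ≠ 0 → k ≠ 1 → ∃ k', k' ≠ 0 ∧ k' ≠ 1 ∧ star (x k) = x k')
    {z : Fin (m + 1) → ℂ} (hz : star z = z) : x 0 ∉ span ℂ {x 2, x 3, x 4, z} := by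
  have hr : Set.range ![x 2, x 3, x 4, z] = {x 2, x 3, x 4, z} := by
    ext v; simp [Matrix.range_cons]; tauto
  have hmem : ∀ k : Fin 5, k ≠ 0 → k ≠ 1 → x k ∈ ({x 2, x 3, x 4, z} : Set _) := by
    intro k h0 h1
    fin_cases k <;> simp at h0 h1 ⊢
  have := notMem_span_range_of_card_lt (x := x 0) ![x 2, x 3, x 4, z] (fun h => ?_)
    (span ℂ (Set.range x)) ?_ (by rw [finrank_span_eq_card hx]; simp)
  · rwa [hr] at this
  · rw [hr] at h ⊢
    refine star_mem_span ?_ h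
    have hk : ∀ k : Fin 5, k ≠ 0 → k ≠ 1 → star (x k) ∈ span ℂ {x 2, x 3, x 4, z} := by
      intro k h0 h1
      obtain ⟨k', h0', h1', e⟩ := hst k h0 h1
      rw [e]
      exact subset_span (hmem k' h0' h1')
    rintro v (rfl | rfl | rfl | rfl)
    · exact hk 2 (by simp) (by simp)
    · exact hk 3 (by simp) (by simp)
    · exact hk 4 (by simp) (by simp)
    · rw [hz]; exact subset_span (by simp)
  · rw [span_le]
    rintro _ ⟨k, rfl⟩
    by_cases h0 : k = 0
    · subst h0; exact mem_sup_left (subset_span (by simp))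
    by_cases h1 : k = 1
    · subst h1; exact mem_sup_left (subset_span (by simp [h01]))
    · exact mem_sup_right (subset_span (hr ▸ hmem k h0 h1))

variable {ι : Type*} [Fintype ι] {y : ι → Fin (m + 1) → ℂ}

/-- The points occurring in a relation with independent points span the latter. -/
theorem mem_span_of_relation (hd : 2 ≤ d) (hx : LinearIndependent ℂ x) {c : Fin 5 → ℂ}
    {a : ι → ℂ} (h : ∑ k, c k • veronese m d (x k) = ∑ j, a j • veronese m d (y j)) (k : Fin 5)
    (hc : c k ≠ 0) : x k ∈ span ℂ (Set.range y) := by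
  by_contra hk
  refine hc (coeff_eq_zero_of_separates h k (((Separates.of_notMem_span ?_).union
    (Separates.of_notMem_span hk)).mono_degree (hx.ne_zero k) hd))
  exact hx.notMem_span_image (s := {j | j ≠ k}) (by simp)

theorem image_ne_zero_subset :
    x '' {k | k ≠ 0} ⊆ {x 1, x 2, x 3, x 4} := by
  rintro _ ⟨k, hk, rfl⟩
  fin_cases k <;> simp at hk ⊢

open Classical in
-- Otherwise `d` forms separate `x 0`: one for `x 2, x 3, x 4` and some `y i`, one for `x 1`, and `d
-- - 2` for the remaining `y i`, of which there are at most `d + 1 ≤ 2 * (d - 2)`, with at most `d -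
-- 2` on the line.
theorem le_card_conjLine_of_card_le (hd : 5 ≤ d) (hx : LinearIndependent ℂ x)
    (h01 : star (x 0) = x 1)
    (hst : ∀ k, k ≠ 0 → k ≠ 1 → ∃ k', k' ≠ 0 ∧ k' ≠ 1 ∧ star (x k) = x k')
    (hy : ∀ i, star (y i) = y i) (hcard : Fintype.card ι ≤ d + 2)
    {c : Fin 5 → ℂ} (hc : ∀ k, c k ≠ 0) {a : ι → ℂ}
    (h : ∑ k, c k • veronese m d (x k) = ∑ j, a j • veronese m d (y j)) :
    d ≤ (Finset.univ.filter fun i => y i ∈ conjLine (x 0)).card := by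
  by_contra! hL
  have hx0 := hx.ne_zero 0
  have hfin := finrank_conjLine hx (by simp) h01
  have hsum := Finset.card_filter_add_card_filter_not (s := (Finset.univ : Finset ι))
    (p := fun i => y i ∈ conjLine (x 0))
  rw [Finset.card_univ] at hsum
  obtain ⟨JL, hJL, Jf, hJf, z, hz, hsub, h1, h2⟩ := exists_pick y hy
    (Finset.univ.filter fun i => y i ∈ conjLine (x 0))
    (Finset.univ.filter fun i => y i ∉ conjLine (x 0))
  have s1 := Separates.of_notMem_span (notMem_span_rest hx h01 hst hz)
  have s2 : Separates 1 (x 0) {x 1} := Separates.of_notMem_span (by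
    have := hx.notMem_span_image (s := {1}) (x := 0) (by simp)
    simpa using this)
  have s3 := Separates.of_pairs y hx0 (d - 2) JL Jf (by omega) (by omega)
    (fun i _ => notMem_span_singleton hfin (hy i))
    (fun i hi j _ => notMem_span_pair hfin (hy i) (hy j) (by simpa using hJf hi))
  refine hc 0 (coeff_eq_zero_of_separates h 0 ((((s1.union s2).union s3).mono ?_).mono_degree hx0
    (by omega)))
  refine Set.union_subset (image_ne_zero_subset.trans ?_) ?_
  · rintro _ (rfl | rfl | rfl | rfl) <;> simp
  · rintro _ ⟨i, rfl⟩
    have := hsub ⟨i, by simp [_root_.em], rfl⟩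
    rcases this with h | h
    · exact Or.inr h
    · exact Or.inl (Or.inl (by simp at h; simp [h]))

open Classical in
-- Such a configuration lets five forms separate `x 2`: one for the span of `x 0, x 1, w`, and one
-- for each of `w₁, w₂, x 3, x 4`. It provides enough points off the line in the next count.
theorem not_exists_conjLine_sup (hd : 5 ≤ d) (hx : LinearIndependent ℂ x)
    (h01 : star (x 0) = x 1) (h23 : star (x 2) = x 3)
    {c : Fin 5 → ℂ} (hc : ∀ k, c k ≠ 0) {a : ι → ℂ}
    (h : ∑ k, c k • veronese m d (x k) = ∑ j, a j • veronese m d (y j))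
    (w w₁ w₂ : Fin (m + 1) → ℂ) (hw : star w = w) (hw₁ : star w₁ = w₁) (hw₂ : star w₂ = w₂)
    (hall : ∀ i, y i ∈ conjLine (x 0) ⊔ span ℂ {w} ∨ y i = w₁ ∨ y i = w₂) : False := by
  have hx2 := hx.ne_zero 2
  have hfin := finrank_conjLine hx (by decide) h23
  have hr : Set.range ![x 0, x 1, w] = {x 0, x 1, w} := by ext v; simp [Matrix.range_cons]; tauto
  have n1 : x 2 ∉ span ℂ {x 0, x 1, w} := by
    have := notMem_span_range_of_card_lt (x := x 2) ![x 0, x 1, w] (fun h => ?_)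
      (span ℂ (Set.range (x ∘ ![0, 1, 2, 3]))) ?_ (by
        rw [finrank_span_eq_card (hx.comp _ (by decide))]; simp)
    · rwa [hr] at this
    · rw [hr] at h ⊢
      refine star_mem_span ?_ h
      rintro v (rfl | rfl | rfl)
      · rw [h01]; exact subset_span (by simp)
      · rw [← h01, star_star]; exact subset_span (by simp)
      · rw [hw]; exact subset_span (by simp)
    · rw [span_le, hr]
      rintro _ ⟨k, rfl⟩
      fin_cases k
      · exact mem_sup_right (subset_span (by simp))
      · exact mem_sup_right (subset_span (by simp))
      · exact mem_sup_left (subset_span (by simp))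
      · exact mem_sup_left (subset_span (by simp [h23]))
  have hWle : conjLine (x 0) ⊔ span ℂ {w} ≤ span ℂ {x 0, x 1, w} := by
    rw [conjLine, h01]
    refine sup_le (span_mono ?_) (span_mono (by simp))
    rintro _ (rfl | rfl) <;> simp
  have s1 : Separates 1 (x 2) (span ℂ {x 0, x 1, w}) :=
    Separates.of_notMem_span (by rwa [span_eq])
  have hs : ∀ k, k ≠ 2 → Separates 1 (x 2) {x k} := fun k hk => Separates.of_notMem_span (by
    have := hx.notMem_span_image (s := {k}) (x := 2) (by simpa using hk.symm)
    simpa using this)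
  have s2 := Separates.of_notMem_span (notMem_span_singleton hfin hw₁)
  have s3 := Separates.of_notMem_span (notMem_span_singleton hfin hw₂)
  refine hc 2 (coeff_eq_zero_of_separates h 2 ((((((s1.union s2).union s3).union
    (hs 3 (by simp))).union (hs 4 (by simp))).mono ?_).mono_degree hx2 (by omega)))
  refine Set.union_subset ?_ ?_
  · rintro _ ⟨k, hk, rfl⟩
    have h0 : x 0 ∈ span ℂ {x 0, x 1, w} := subset_span (by simp)
    have h1 : x 1 ∈ span ℂ {x 0, x 1, w} := subset_span (by simp)
    fin_cases k <;> simp [h0, h1] at hk ⊢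
  · rintro _ ⟨i, rfl⟩
    rcases hall i with hi | hi | hi
    · have := hWle hi
      simp [this]
    · simp [hi]
    · simp [hi]

open Classical in
-- Killing two `y i` per form is not quite enough, because the other `x k` use up forms. So two
-- disjoint pairs of `y i`, each raising the dimension of the line by two, are found: a form can
-- kill such a pair and a third point. The forms are one for `x 2, x 3, x 4, z₁`, one for `x 1` and
-- the first pair, one for `z₂` and the second pair, and `d - 3` for the remaining `2 * d - 6` or
-- fewer points.
theorem le_card_conjLine_of_card_le_two_mul (hd : 5 ≤ d) (hx : LinearIndependent ℂ x)
    (h01 : star (x 0) = x 1) (h23 : star (x 2) = x 3) (h4 : star (x 4) = x 4)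
    (hy : ∀ i, star (y i) = y i) (hcard : Fintype.card ι ≤ 2 * d)
    {c : Fin 5 → ℂ} (hc : ∀ k, c k ≠ 0) {a : ι → ℂ}
    (h : ∑ k, c k • veronese m d (x k) = ∑ j, a j • veronese m d (y j)) :
    d ≤ (Finset.univ.filter fun i => y i ∈ conjLine (x 0)).card := by
  by_contra! hL
  have hx0 := hx.ne_zero 0
  have hfin := finrank_conjLine hx (by simp) h01
  have hst : ∀ k, k ≠ 0 → k ≠ 1 → ∃ k', k' ≠ 0 ∧ k' ≠ 1 ∧ star (x k) = x k' := by
    intro k h0 h1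
    fin_cases k
    · simp at h0
    · simp at h1
    · exact ⟨3, by simp, by simp, h23⟩
    · exact ⟨2, by simp, by simp, by simp [← h23]⟩
    · exact ⟨4, by simp, by simp, h4⟩
  have hsum := Finset.card_filter_add_card_filter_not (s := (Finset.univ : Finset ι))
    (p := fun i => y i ∈ conjLine (x 0))
  rw [Finset.card_univ] at hsum
  have key := not_exists_conjLine_sup hd hx h01 h23 hc h
  have hpair : ∀ w₁ w₂, star w₁ = w₁ → star w₂ = w₂ → ∃ i j, y i ∉ conjLine (x 0) ∧
      y j ∉ conjLine (x 0) ⊔ span ℂ {y i} ∧ y i ≠ w₁ ∧ y i ≠ w₂ ∧ y j ≠ w₁ ∧ y j ≠ w₂ := by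
    intro w₁ w₂ hw₁ hw₂
    by_contra! hno
    by_cases hi : ∃ i, y i ∉ conjLine (x 0) ∧ y i ≠ w₁ ∧ y i ≠ w₂
    · obtain ⟨i, h1, h2, h3⟩ := hi
      refine key (y i) w₁ w₂ (hy i) hw₁ hw₂ fun j => ?_
      by_contra! hj
      exact hj.2.2 (hno i j h1 hj.1 h2 h3 hj.2.1)
    · push Not at hi
      refine key 0 w₁ w₂ (by simp) hw₁ hw₂ fun j => ?_
      by_contra! hj
      exact hj.2.2 (hi j (fun hh => hj.1 (mem_sup_left hh)) hj.2.1)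
  obtain ⟨i₁, i₂, a1, a2, -⟩ := hpair 0 0 (by simp) (by simp)
  obtain ⟨i₃, i₄, b1, b2, b3, b4, b5, b6⟩ := hpair (y i₁) (y i₂) (hy _) (hy _)
  have a3 : y i₂ ∉ conjLine (x 0) := fun hh => a2 (mem_sup_left hh)
  have b7 : y i₄ ∉ conjLine (x 0) := fun hh => b2 (mem_sup_left hh)
  have e12 : i₁ ≠ i₂ := fun e => a2 (e ▸ mem_sup_right (mem_span_singleton_self _))
  have e34 : i₃ ≠ i₄ := fun e => b2 (e ▸ mem_sup_right (mem_span_singleton_self _))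
  have e13 : i₁ ≠ i₃ := fun e => b3 (by rw [e])
  have e23 : i₂ ≠ i₃ := fun e => b4 (by rw [e])
  have e14 : i₁ ≠ i₄ := fun e => b5 (by rw [e])
  have e24 : i₂ ≠ i₄ := fun e => b6 (by rw [e])
  set JL₀ := Finset.univ.filter fun i => y i ∈ conjLine (x 0) with hJL₀
  set Jf₀ := Finset.univ.filter fun i => y i ∉ conjLine (x 0) with hJf₀
  have hq : ({i₁, i₂, i₃, i₄} : Finset ι) ⊆ Jf₀ := by
    simp [Finset.insert_subset_iff, hJf₀, a1, a3, b1, b7]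
  have hqc : ({i₁, i₂, i₃, i₄} : Finset ι).card = 4 := by
    simp [Finset.card_insert_of_notMem, e12, e34, e13, e23, e14, e24]
  have hq' := Finset.card_sdiff_add_card_eq_card hq
  -- Removing `z₁` and `z₂`, from the line when possible, leaves at most `d - 3` points on it, as
  -- `of_pairs` requires.
  obtain ⟨JL₁, hJL₁, Jf₁, hJf₁, z₁, hz₁, hsub₁, h1, h2⟩ := exists_pick y hy JL₀
    (Jf₀ \ {i₁, i₂, i₃, i₄})
  obtain ⟨JL₂, hJL₂, Jf₂, hJf₂, z₂, hz₂, hsub₂, h1', h2'⟩ := exists_pick y hy JL₁ Jf₁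
  have s1 := Separates.of_notMem_span (notMem_span_rest hx h01 hst hz₁)
  have s2 := Separates.of_notMem_span (notMem_span_triple hfin (hy i₁) (hy i₂)
    (z := x 1) (Or.inr h01.symm) a1 a2)
  have s3 := Separates.of_notMem_span (notMem_span_triple hfin (hy i₃) (hy i₄)
    (Or.inl hz₂) b1 b2)
  have s4 := Separates.of_pairs y hx0 (d - 3) JL₂ Jf₂ (by omega) (by omega)
    (fun i _ => notMem_span_singleton hfin (hy i))
    (fun i hi j _ => notMem_span_pair hfin (hy i) (hy j)
      (by simpa [hJf₀] using (Finset.sdiff_subset (hJf₁ (hJf₂ hi)) : i ∈ Jf₀)))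
  refine hc 0 (coeff_eq_zero_of_separates h 0 (((((s1.union s2).union s3).union s4).mono
    ?_).mono_degree hx0 (by omega)))
  refine Set.union_subset (image_ne_zero_subset.trans ?_) ?_
  · rintro _ (rfl | rfl | rfl | rfl) <;> simp
  · rintro _ ⟨i, rfl⟩
    by_cases hi : i ∈ ({i₁, i₂, i₃, i₄} : Finset ι)
    · simp only [Finset.mem_insert, Finset.mem_singleton] at hi
      rcases hi with rfl | rfl | rfl | rfl <;> simp
    · have hm : i ∈ JL₀ ∪ (Jf₀ \ {i₁, i₂, i₃, i₄}) := by
        rw [Finset.mem_union, Finset.mem_sdiff]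
        by_cases hh : y i ∈ conjLine (x 0)
        · exact Or.inl (by simpa [hJL₀])
        · exact Or.inr ⟨by simpa [hJf₀], hi⟩
      rcases hsub₁ ⟨i, hm, rfl⟩ with ⟨j, hj, e⟩ | e
      · rw [← e]
        rcases hsub₂ ⟨j, hj, rfl⟩ with e | e
        · exact Or.inr e
        · simp at e; simp [e]
      · simp at e; simp [e]

theorem four_lt_card (hd : 2 ≤ d) (hx : LinearIndependent ℂ x)
    {c : Fin 5 → ℂ} (hc : ∀ k, c k ≠ 0) {a : ι → ℂ}
    (h : ∑ k, c k • veronese m d (x k) = ∑ j, a j • veronese m d (y j)) :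
    4 < Fintype.card ι := by
  have h1 : span ℂ (Set.range x) ≤ span ℂ (Set.range y) := by
    rw [span_le]
    rintro _ ⟨k, rfl⟩
    exact mem_span_of_relation hd hx h k (hc k)
  have h2 := finrank_mono h1
  have h3 := finrank_range_le_card (R := ℂ) y
  rw [finrank_span_eq_card hx, Fintype.card_fin] at h2
  rw [Set.finrank] at h3
  omega

open Classical in
-- With `d` points on the line at most two are left, so everything lies in dimension four, whereas
-- the `y i` must span the five `x k`.
theorem add_two_lt_card (hd : 5 ≤ d) (hx : LinearIndependent ℂ x)
    (h01 : star (x 0) = x 1)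
    (hst : ∀ k, k ≠ 0 → k ≠ 1 → ∃ k', k' ≠ 0 ∧ k' ≠ 1 ∧ star (x k) = x k')
    (hy : ∀ i, star (y i) = y i)
    {c : Fin 5 → ℂ} (hc : ∀ k, c k ≠ 0) {a : ι → ℂ}
    (h : ∑ k, c k • veronese m d (x k) = ∑ j, a j • veronese m d (y j)) :
    d + 2 < Fintype.card ι := by
  by_contra! hcard
  have hL := le_card_conjLine_of_card_le hd hx h01 hst hy hcard hc h
  have hsum := Finset.card_filter_add_card_filter_not (s := (Finset.univ : Finset ι))
    (p := fun i => y i ∈ conjLine (x 0))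
  rw [Finset.card_univ] at hsum
  have hfin := finrank_conjLine hx (by simp) h01
  set Jf := Finset.univ.filter fun i => y i ∉ conjLine (x 0) with hJf
  have h1 : span ℂ (Set.range x) ≤ conjLine (x 0) ⊔ span ℂ (Jf.image y : Finset _) := by
    rw [span_le]
    rintro _ ⟨k, rfl⟩
    refine (span_le.2 ?_) (mem_span_of_relation (by omega) hx h k (hc k))
    rintro _ ⟨i, rfl⟩
    by_cases hi : y i ∈ conjLine (x 0)
    · exact mem_sup_left hi
    · exact mem_sup_right (subset_span (by
        simp only [Finset.coe_image]; exact ⟨i, by simpa [hJf] using hi, rfl⟩))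
  have h2 := finrank_mono h1
  have h3 := finrank_span_finset_le_card (R := ℂ) (Jf.image y)
  have h4 := Finset.card_image_le (s := Jf) (f := y)
  have h5 := finrank_add_le_finrank_add_finrank (conjLine (x 0))
    (span ℂ ((Jf.image y : Finset _) : Set (Fin (m + 1) → ℂ)))
  rw [finrank_span_eq_card hx, Fintype.card_fin] at h2
  rw [Set.finrank] at h3
  omega

open Classical in
theorem two_mul_lt_card (hd : 5 ≤ d) (hx : LinearIndependent ℂ x)
    (h01 : star (x 0) = x 1) (h23 : star (x 2) = x 3) (h4 : star (x 4) = x 4)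
    (hy : ∀ i, star (y i) = y i) (hy0 : ∀ i, y i ≠ 0)
    {c : Fin 5 → ℂ} (hc : ∀ k, c k ≠ 0) {a : ι → ℂ}
    (h : ∑ k, c k • veronese m d (x k) = ∑ j, a j • veronese m d (y j)) :
    2 * d < Fintype.card ι := by
  by_contra! hcard
  have hL := le_card_conjLine_of_card_le_two_mul hd hx h01 h23 h4 hy hcard hc h
  -- Exchanging the two conjugate pairs gives the same bound for the line of `x 2`.
  set e : Equiv.Perm (Fin 5) := Equiv.swap 0 2 * Equiv.swap 1 3 with he
  have hM := le_card_conjLine_of_card_le_two_mul (x := x ∘ e) hd (hx.comp e e.injective)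
    (by simpa [he, Equiv.swap_apply_def] using h23) (by simpa [he, Equiv.swap_apply_def] using h01)
    (by simpa [he, Equiv.swap_apply_def] using h4) hy hcard (c := c ∘ e) (fun k => hc _)
    ((Equiv.sum_comp e fun k => c k • veronese m d (x k)).trans h)
  have he0 : e 0 = 2 := by decide
  simp only [Function.comp_apply, he0] at hM
  have hdisj : Disjoint (conjLine (x 0)) (conjLine (x 2)) := by
    have := hx.disjoint_span_image (s := {0, 1}) (t := {2, 3}) (by simp)
    rw [conjLine, conjLine, h01, h23]
    simpa [Set.image_pair] using this
  set JL := Finset.univ.filter fun i => y i ∈ conjLine (x 0) with hJL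
  set JM := Finset.univ.filter fun i => y i ∈ conjLine (x 2) with hJM
  -- The lines share only the zero vector, which is why the `y i` have to be nonzero.
  have hJ : Disjoint JL JM := by
    rw [Finset.disjoint_left]
    intro i hi hi'
    exact hy0 i ((Submodule.disjoint_def.1 hdisj) _ (by simpa [hJL] using hi)
      (by simpa [hJM] using hi'))
  have hc1 := Finset.card_union_of_disjoint hJ
  have huniv : JL ∪ JM = Finset.univ := by
    rw [← Finset.card_eq_iff_eq_univ]
    have := Finset.card_le_univ (JL ∪ JM)
    omega
  have h4' := mem_span_of_relation (by omega) hx h 4 (hc 4)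
  have hle : span ℂ (Set.range y) ≤ span ℂ (x '' {k | k ≠ 4}) := by
    rw [span_le]
    rintro _ ⟨i, rfl⟩
    have hi : i ∈ JL ∪ JM := by rw [huniv]; simp
    have hx4 : ∀ k, k ≠ 4 → x k ∈ x '' {k | k ≠ 4} := fun k hk => ⟨k, hk, rfl⟩
    rcases Finset.mem_union.1 hi with hi | hi
    · refine span_mono ?_ (show y i ∈ conjLine (x 0) by simpa [hJL] using hi)
      rintro _ (rfl | rfl)
      exacts [hx4 0 (by simp), h01 ▸ hx4 1 (by simp)]
    · refine span_mono ?_ (show y i ∈ conjLine (x 2) by simpa [hJM] using hi)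
      rintro _ (rfl | rfl)
      exacts [hx4 2 (by decide), h23 ▸ hx4 3 (by decide)]
  exact hx.notMem_span_image (s := {k | k ≠ 4}) (x := 4) (by simp) (hle h4')

end LowerBounds

/-! ### A conjugate pair as a combination of `d` real points -/

theorem Sym.exists_fun {α : Type*} {d : ℕ} (s : Sym α d) :
    ∃ f : Fin d → α, ∀ {M : Type} [CommMonoid M] (g : α → M),
      ((s : Multiset α).map g).prod = ∏ t, g (f t) := by
  obtain ⟨s, hs⟩ := s
  induction s using Quot.inductionOn with
  | h l =>
    subst hs
    exact ⟨fun t => l[t.1]'t.2, fun g => (Fin.prod_univ_fun_getElem l g).symm⟩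

theorem sum_fin_pow_eq {d : ℕ} {η : ℂ} (hη : IsPrimitiveRoot η d) {a : ℕ}
    (ha : ¬ d ∣ a) : ∑ k : Fin d, (η ^ a) ^ (k : ℕ) = 0 := by
  have h1 : η ^ a ≠ 1 := fun h => ha ((hη.pow_eq_one_iff_dvd a).1 h)
  rw [Fin.sum_univ_eq_sum_range (fun k => (η ^ a) ^ k) d, geom_sum_eq h1, ← pow_mul, mul_comm,
    pow_mul, hη.pow_eq_one]
  simp

/-- The sum of the `d`-th powers of two variables, up to a factor, as an alternating sum of `d`
products symmetric under conjugation. -/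
theorem sum_neg_one_pow_mul_prod_add {d : ℕ} (hd : 0 < d) (A B : Fin d → ℂ) {ζ : ℂ}
    (hζd : ζ ^ d = -1) (hη : IsPrimitiveRoot (ζ ^ 2) d) :
    ∑ k : Fin d, (-1 : ℂ) ^ (k : ℕ) * ∏ t, (ζ ^ (k : ℕ) * A t + (ζ ^ (k : ℕ))⁻¹ * B t) =
      d * (∏ t, A t + ∏ t, B t) := by
  have hζ : ζ ≠ 0 := by
    rintro rfl
    rw [zero_pow hd.ne'] at hζd
    norm_num at hζd
  -- In the expansion over subsets `T`, the sign `ζ ^ (d * k)` turns the exponent `k * (|T| - (d -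
  -- |T|))` into `2 * k * |T|`. Summing over `k` leaves only the `T` with `d ∣ |T|`, that is, the
  -- empty and the full set.
  have hterm : ∀ (k : Fin d) (T : Finset (Fin d)),
      (-1 : ℂ) ^ (k : ℕ) * ((∏ t ∈ T, ζ ^ (k : ℕ) * A t) * ∏ t ∈ Finset.univ \ T,
        (ζ ^ (k : ℕ))⁻¹ * B t) =
      ((∏ t ∈ T, A t) * ∏ t ∈ Finset.univ \ T, B t) * ((ζ ^ 2) ^ T.card) ^ (k : ℕ) := by
    intro k T
    have hc : (Finset.univ \ T).card + T.card = d := by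
      rw [Finset.card_sdiff_add_card_eq_card (Finset.subset_univ T)]; simp
    rw [Finset.prod_mul_distrib, Finset.prod_mul_distrib, Finset.prod_const, Finset.prod_const,
      ← hζd]
    have h1 : (ζ ^ d) ^ (k : ℕ) * (ζ ^ (k : ℕ)) ^ T.card *
        ((ζ ^ (k : ℕ))⁻¹) ^ (Finset.univ \ T).card = ((ζ ^ 2) ^ T.card) ^ (k : ℕ) := by
      rw [inv_pow, mul_inv_eq_iff_eq_mul₀ (pow_ne_zero _ (pow_ne_zero _ hζ))]
      simp only [← pow_mul, ← pow_add]
      congr 1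
      generalize (k : ℕ) = n
      have h2 := congrArg (· * n) hc
      rw [← h2]
      ring
    rw [← h1]
    ring
  simp only [Finset.prod_add, Finset.mul_sum, hterm]
  rw [Finset.sum_comm]
  simp only [← Finset.mul_sum]
  have hsub : ({∅, Finset.univ} : Finset (Finset (Fin d))) ⊆ Finset.univ.powerset := by simp
  have hne : (∅ : Finset (Fin d)) ≠ Finset.univ := by
    intro h
    have := congrArg Finset.card h
    simp at this
    omega
  rw [← Finset.sum_subset hsub, Finset.sum_pair hne]
  · simp [hη.pow_eq_one]
    ring
  · intro T _ hT
    rw [sum_fin_pow_eq hη, mul_zero]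
    intro hdvd
    simp only [Finset.mem_insert, Finset.mem_singleton, not_or] at hT
    rcases Nat.eq_zero_or_pos T.card with h | h
    · exact hT.1 (Finset.card_eq_zero.1 h)
    · have h1 := Nat.le_of_dvd h hdvd
      refine hT.2 ((Finset.card_eq_iff_eq_univ T).1 (le_antisymm (Finset.card_le_univ _) ?_))
      simpa using h1

section InSpan

variable {m d : ℕ}

theorem inSpanOfPoints_iff {K : Type} [Field K] {k : ℕ} {p : VeroneseSpace K m d} :
    InSpanOfPoints m d k p ↔
      ∃ (x : Fin k → Fin (m + 1) → K) (a : Fin k → K), p = ∑ i, a i • veronese m d (x i) := by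
  refine exists_congr fun x => ?_
  rw [Submodule.mem_span_range_iff_exists_fun]
  exact exists_congr fun a => eq_comm

theorem InSpanOfPoints.add {K : Type} [Field K] {k l : ℕ} {p q : VeroneseSpace K m d}
    (hp : InSpanOfPoints m d k p) (hq : InSpanOfPoints m d l q) :
    InSpanOfPoints m d (k + l) (p + q) := by
  rw [inSpanOfPoints_iff] at *
  obtain ⟨x, a, rfl⟩ := hp
  obtain ⟨y, b, rfl⟩ := hq
  exact ⟨Fin.append x y, Fin.append a b, by simp [Fin.sum_univ_add]⟩

/-- The real part of a multiple of a complex point of the Veronese variety. -/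
noncomputable def veroneseRe (m d : ℕ) (c : ℂ) (x : Fin (m + 1) → ℂ) : VeroneseSpace ℝ m d :=
  fun s => (c * veronese m d x s).re

theorem star_veronese (x : Fin (m + 1) → ℂ) (s : Sym (Fin (m + 1)) d) :
    star (veronese m d x s) = veronese m d (star x) s := by
  obtain ⟨f, hf⟩ := s.exists_fun
  simp [veronese, hf]

theorem veronese_ofReal (u : Fin (m + 1) → ℝ) (s : Sym (Fin (m + 1)) d) :
    veronese m d (fun i => (u i : ℂ)) s = (veronese m d u s : ℝ) := by
  obtain ⟨f, hf⟩ := s.exists_fun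
  simp [veronese, hf]

theorem veronese_smul {K : Type} [Field K] (γ : K) (x : Fin (m + 1) → K) :
    veronese m d (γ • x) = γ ^ d • veronese m d x := by
  ext s
  obtain ⟨f, hf⟩ := s.exists_fun
  change _ = γ ^ d * _
  simp [veronese, hf, Finset.prod_mul_distrib]

theorem veroneseRe_star (c : ℂ) (x : Fin (m + 1) → ℂ) :
    veroneseRe m d c (star x) = veroneseRe m d (star c) x := by
  ext s
  rw [veroneseRe, veroneseRe, ← star_veronese, ← Complex.conj_re]
  simp

theorem veroneseRe_add (c c' : ℂ) (x : Fin (m + 1) → ℂ) :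
    veroneseRe m d c x + veroneseRe m d c' x = veroneseRe m d (c + c') x := by
  ext s
  simp only [Pi.add_apply, veroneseRe, add_mul, Complex.add_re]

theorem exists_ofReal_eq {x : Fin (m + 1) → ℂ} (hx : star x = x) :
    ∃ u : Fin (m + 1) → ℝ, x = fun i => (u i : ℂ) :=
  ⟨fun i => (x i).re, funext fun i => (Complex.conj_eq_iff_re.1 (congrFun hx i)).symm⟩

theorem inSpanOfPoints_veroneseRe_of_real (c : ℂ) {x : Fin (m + 1) → ℂ} (hx : star x = x) :
    InSpanOfPoints m d 1 (veroneseRe m d c x) := by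
  obtain ⟨u, rfl⟩ := exists_ofReal_eq hx
  rw [inSpanOfPoints_iff]
  refine ⟨fun _ => u, fun _ => c.re, ?_⟩
  ext s
  simp [veroneseRe, veronese_ofReal]

theorem inSpanOfPoints_veroneseRe (hd : 0 < d) (c : ℂ) (x : Fin (m + 1) → ℂ) :
    InSpanOfPoints m d d (veroneseRe m d c x) := by
  -- Absorb the coefficient into the point.
  obtain ⟨γ, hγ⟩ := IsAlgClosed.exists_pow_nat_eq c hd
  set w := γ • x with hw
  have hre : veroneseRe m d c x = fun s => (veronese m d w s).re := by
    ext s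
    rw [hw, veronese_smul, hγ]
    rfl
  set ζ := Complex.exp (Real.pi * Complex.I / d) with hζ
  have hd' : (d : ℂ) ≠ 0 := by exact_mod_cast hd.ne'
  have hζd : ζ ^ d = -1 := by
    rw [hζ, ← Complex.exp_nat_mul, mul_div_cancel₀ _ hd', Complex.exp_pi_mul_I]
  have hη : IsPrimitiveRoot (ζ ^ 2) d := by
    have := Complex.isPrimitiveRoot_exp d hd.ne'
    convert this using 1
    rw [hζ, ← Complex.exp_nat_mul]
    congr 1
    push_cast
    ring
  have hconj : (starRingEnd ℂ) ζ = ζ⁻¹ := by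
    rw [hζ, ← Complex.exp_conj, ← Complex.exp_neg]
    congr 1
    simp [Complex.conj_ofReal, neg_div]
  rw [inSpanOfPoints_iff]
  -- As `ζ` has modulus one, `ζ ^ k * w + ζ⁻ᵏ * conj w` is twice a real part. The alternating sum is
  -- `d` times a number plus its conjugate, hence the factor `2 * d`.
  refine ⟨fun k i => 2 * (ζ ^ (k : ℕ) * w i).re, fun k => (-1) ^ (k : ℕ) / (2 * d), ?_⟩
  rw [hre]
  ext s
  obtain ⟨f, hf⟩ := s.exists_fun
  have key := sum_neg_one_pow_mul_prod_add hd (fun t => w (f t))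
    (fun t => (starRingEnd ℂ) (w (f t))) hζd hη
  apply Complex.ofReal_injective
  rw [Finset.sum_apply]
  change _ = ((∑ k : Fin d, (-1) ^ (k : ℕ) / (2 * d : ℝ) *
    veronese m d (fun i => 2 * (ζ ^ (k : ℕ) * w i).re) s : ℝ) : ℂ)
  have h1 : ∀ k : Fin d, ((veronese m d (fun i => 2 * (ζ ^ (k : ℕ) * w i).re) s : ℝ) : ℂ) =
      ∏ t, (ζ ^ (k : ℕ) * w (f t) + (ζ ^ (k : ℕ))⁻¹ * (starRingEnd ℂ) (w (f t))) := by
    intro k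
    simp only [veronese, hf, Complex.ofReal_prod]
    refine Finset.prod_congr rfl fun t _ => ?_
    rw [← Complex.add_conj, map_mul, map_pow, hconj, inv_pow]
  push_cast
  simp only [h1, div_mul_eq_mul_div]
  rw [← Finset.sum_div, key, ← map_prod]
  simp only [veronese, hf]
  rw [Complex.add_conj]
  field_simp
  push_cast
  ring

theorem eq_sum_veroneseRe {p : VeroneseSpace ℝ m d} {c : Fin 5 → ℂ}
    {x : Fin 5 → Fin (m + 1) → ℂ}
    (h : (fun s => (p s : ℂ)) = ∑ k, c k • veronese m d (x k)) :
    p = ∑ k, veroneseRe m d (c k) (x k) := by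
  ext s
  have := congrArg Complex.re (congrFun h s)
  simpa [veroneseRe] using this

theorem InSpanOfPoints.exists_relation {k : ℕ} {p : VeroneseSpace ℝ m d} (hd : d ≠ 0)
    (h : InSpanOfPoints m d k p) :
    ∃ (ι : Type) (_ : Fintype ι) (a : ι → ℂ) (y : ι → Fin (m + 1) → ℂ),
      Fintype.card ι ≤ k ∧ (∀ i, star (y i) = y i) ∧ (∀ i, y i ≠ 0) ∧
      (fun s => (p s : ℂ)) = ∑ i, a i • veronese m d (y i) := by
  classical
  rw [inSpanOfPoints_iff] at h
  obtain ⟨u, a, rfl⟩ := h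
  set y : Fin k → Fin (m + 1) → ℂ := fun j i => (u j i : ℂ) with hy
  -- Zero vectors contribute nothing since `d ≠ 0`, and are dropped.
  refine ⟨{j : Fin k // y j ≠ 0}, inferInstance, fun j => a j, fun j => y j, ?_, ?_,
    fun j => j.2, ?_⟩
  · exact (Fintype.card_subtype_le _).trans (by simp)
  · intro j; ext i; simp [hy]
  · have h1 : (fun s => (((∑ i, a i • veronese m d (u i)) s : ℝ) : ℂ)) =
        ∑ j, (a j : ℂ) • veronese m d (y j) := by
      ext s
      simp [hy, veronese_ofReal]
    rw [h1, ← Finset.sum_subtype (Finset.univ.filter fun j => y j ≠ 0) (by simp)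
      (fun j => (a j : ℂ) • veronese m d (y j)), Finset.sum_filter]
    refine Finset.sum_congr rfl fun j _ => ?_
    by_cases hj : y j = 0
    · simp [hj, veronese_zero hd]
    · simp [hj]

end InSpan

/-! ### Real rank of a sum of five independent points -/

section Rank

variable {m d : ℕ} {p : VeroneseSpace ℝ m d} {c : Fin 5 → ℂ} {x : Fin 5 → Fin (m + 1) → ℂ}

theorem hasRank_five (hd : 10 ≤ d) (hx : LinearIndependent ℂ x) (hc : ∀ k, c k ≠ 0)
    (h : (fun s => (p s : ℂ)) = ∑ k, c k • veronese m d (x k))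
    (hr : ∀ k, star (x k) = x k) : HasRank m d p 5 := by
  constructor
  · rw [Set.mem_ofPred_eq, eq_sum_veroneseRe h]
    simp only [Fin.sum_univ_five]
    have := fun k => inSpanOfPoints_veroneseRe_of_real (d := d) (c k) (hr k)
    exact ((((this 0).add (this 1)).add (this 2)).add (this 3)).add (this 4)
  · intro k hk
    obtain ⟨ι, _, a, y, hcard, -, -, hrel⟩ := InSpanOfPoints.exists_relation (by omega) hk
    have := four_lt_card (by omega) hx hc (h.symm.trans hrel)
    omega

theorem hasRank_add_three (hd : 10 ≤ d) (hx : LinearIndependent ℂ x) (hc : ∀ k, c k ≠ 0)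
    (h : (fun s => (p s : ℂ)) = ∑ k, c k • veronese m d (x k))
    (h01 : star (x 0) = x 1) (h2 : star (x 2) = x 2) (h3 : star (x 3) = x 3)
    (h4 : star (x 4) = x 4) : HasRank m d p (d + 3) := by
  constructor
  · rw [Set.mem_ofPred_eq, eq_sum_veroneseRe h]
    simp only [Fin.sum_univ_five]
    rw [← h01, veroneseRe_star, veroneseRe_add]
    exact (((inSpanOfPoints_veroneseRe (by omega) _ (x 0)).add
      (inSpanOfPoints_veroneseRe_of_real (d := d) (c 2) h2)).add
      (inSpanOfPoints_veroneseRe_of_real (d := d) (c 3) h3)).add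
      (inSpanOfPoints_veroneseRe_of_real (d := d) (c 4) h4)
  · intro k hk
    obtain ⟨ι, _, a, y, hcard, hy, -, hrel⟩ := InSpanOfPoints.exists_relation (by omega) hk
    have := add_two_lt_card (by omega) hx h01 (by
      intro k h0 h1
      refine ⟨k, h0, h1, ?_⟩
      fin_cases k
      exacts [absurd rfl h0, absurd rfl h1, h2, h3, h4]) hy hc (h.symm.trans hrel)
    omega

theorem hasRank_two_mul_add_one (hd : 10 ≤ d) (hx : LinearIndependent ℂ x) (hc : ∀ k, c k ≠ 0)
    (h : (fun s => (p s : ℂ)) = ∑ k, c k • veronese m d (x k))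
    (h01 : star (x 0) = x 1) (h23 : star (x 2) = x 3)
    (h4 : star (x 4) = x 4) : HasRank m d p (2 * d + 1) := by
  constructor
  · rw [Set.mem_ofPred_eq, eq_sum_veroneseRe h]
    simp only [Fin.sum_univ_five]
    rw [← h01, veroneseRe_star, veroneseRe_add, add_assoc (veroneseRe m d _ (x 0)),
      ← h23, veroneseRe_star, veroneseRe_add, two_mul]
    exact ((inSpanOfPoints_veroneseRe (by omega) _ (x 0)).add
      (inSpanOfPoints_veroneseRe (by omega) _ (x 2))).add
      (inSpanOfPoints_veroneseRe_of_real (d := d) (c 4) h4)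
  · intro k hk
    obtain ⟨ι, _, a, y, hcard, hy, hy0, hrel⟩ := InSpanOfPoints.exists_relation (by omega) hk
    have := two_mul_lt_card (by omega) hx h01 h23 h4 hy hy0 hc (h.symm.trans hrel)
    omega

/-- Conjugacy classes are given by cycle types, and at most two transpositions fit into five
letters. -/
theorem Equiv.Perm.exists_conj_of_involutive (σ : Equiv.Perm (Fin 5)) (hσ : ∀ k, σ (σ k) = k) :
    ∃ e : Equiv.Perm (Fin 5), ∃ τ : Equiv.Perm (Fin 5), (∀ k, σ (e k) = e (τ k)) ∧
      (τ = 1 ∨ τ = Equiv.swap 0 1 ∨ τ = Equiv.swap 0 1 * Equiv.swap 2 3) := by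
  have key : ∀ τ : Equiv.Perm (Fin 5), σ.cycleType = τ.cycleType →
      ∃ e : Equiv.Perm (Fin 5), ∀ k, σ (e k) = e (τ k) := by
    intro τ h
    obtain ⟨e, he⟩ := isConj_iff.1 (Equiv.Perm.isConj_iff_cycleType_eq.2 h.symm)
    exact ⟨e, fun k => by rw [← he]; simp⟩
  by_cases h1 : σ = 1
  · exact ⟨1, 1, by simp [h1], Or.inl rfl⟩
  have h2 : orderOf σ = 2 := orderOf_eq_prime (by ext k; simp [pow_two, hσ]) h1
  obtain ⟨n, hn⟩ := Equiv.Perm.cycleType_prime_order (σ := σ) (by rw [h2]; exact Nat.prime_two)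
  rw [h2] at hn
  have h3 : σ.cycleType.sum ≤ 5 := by
    rw [Equiv.Perm.sum_cycleType]
    exact (Finset.card_le_univ _).trans (by simp)
  have s1 : (Equiv.swap (0 : Fin 5) 1).cycleType = {2} :=
    by rw [(Equiv.Perm.isCycle_swap (by simp)).cycleType, Equiv.Perm.card_support_swap (by simp)]
  have s2 : (Equiv.swap (2 : Fin 5) 3).cycleType = {2} :=
    by rw [(Equiv.Perm.isCycle_swap (by decide)).cycleType, Equiv.Perm.card_support_swap (by decide)]
  have hn' : n = 0 ∨ n = 1 := by
    rw [hn] at h3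
    simp at h3
    omega
  rcases hn' with rfl | rfl
  · obtain ⟨e, he⟩ := key (Equiv.swap 0 1) (by rw [hn, s1]; rfl)
    exact ⟨e, _, he, Or.inr (Or.inl rfl)⟩
  · have hdis : (Equiv.swap (0 : Fin 5) 1).Disjoint (Equiv.swap 2 3) := by
      intro k; revert k; decide
    obtain ⟨e, he⟩ := key (Equiv.swap 0 1 * Equiv.swap 2 3) (by
      rw [hn, hdis.cycleType_mul, s1, s2]; rfl)
    exact ⟨e, _, he, Or.inr (Or.inr rfl)⟩

/-- The real rank of a combination of five independent points, permuted by the conjugation,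
depends on the number of real points only. -/
theorem exists_hasRank (hd : 10 ≤ d) (hx : LinearIndependent ℂ x) (hc : ∀ k, c k ≠ 0)
    (h : (fun s => (p s : ℂ)) = ∑ k, c k • veronese m d (x k))
    (σ : Equiv.Perm (Fin 5)) (hσ : ∀ k, star (x k) = x (σ k)) :
    ∃ r ∈ ({5, d + 3, 2 * d + 1} : Set ℕ), HasRank m d p r := by
  obtain ⟨e, τ, he, hτ⟩ := σ.exists_conj_of_involutive fun k => hx.injective (by
    rw [← hσ, ← hσ, star_star])
  have hx' := hx.comp e e.injective
  have hc' : ∀ k, (c ∘ e) k ≠ 0 := fun k => hc _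
  have h' : (fun s => (p s : ℂ)) = ∑ k, (c ∘ e) k • veronese m d ((x ∘ e) k) :=
    h.trans (Equiv.sum_comp e fun k => c k • veronese m d (x k)).symm
  have hs : ∀ k, star ((x ∘ e) k) = (x ∘ e) (τ k) := fun k => by
    simp only [Function.comp_apply, hσ, he]
  rcases hτ with rfl | rfl | rfl
  · exact ⟨5, by simp, hasRank_five hd hx' hc' h' hs⟩
  · exact ⟨d + 3, by simp, hasRank_add_three hd hx' hc' h' (hs 0) (hs 2) (hs 3) (hs 4)⟩
  · exact ⟨2 * d + 1, by simp, hasRank_two_mul_add_one hd hx' hc' h' (hs 0) (hs 2) (hs 4)⟩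

end Rank

/-! ### Catalecticants and the genericity polynomial -/

section Catalecticant

variable {R : Type*} [CommRing R] {m d : ℕ}

/-- The sum of five points of the affine cone over the Veronese variety. -/
def veroneseSum (m d : ℕ) (x : Fin 5 → Fin (m + 1) → R) : Sym (Fin (m + 1)) d → R :=
  fun s => ∑ k, ((s : Multiset (Fin (m + 1))).map (x k)).prod

/-- The multiset of size `d` obtained from a list of length at most `d` by adding zeros. -/
def padZero {m : ℕ} (d : ℕ) (l : List (Fin (m + 1))) : Sym (Fin (m + 1)) d :=
  ⟨Multiset.replicate (d - l.length) 0 + (l.take d : Multiset (Fin (m + 1))), by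
    simp only [Multiset.card_add, Multiset.card_replicate, Multiset.coe_card, List.length_take]
    omega⟩

/-- The first five coordinates. -/
def coord (m : ℕ) (j : Fin 5) : Fin (m + 1) := Fin.ofNat (m + 1) j

/-- A `5 × 5` block of the catalecticant. -/
def catMatrix (p : Sym (Fin (m + 1)) d → R) : Matrix (Fin 5) (Fin 5) R :=
  Matrix.of fun j l => p (padZero d [coord m j, coord m l])

/-- The analogue of `catMatrix` for the derivative in the direction `i`. -/
def catMatrixAt (i : Fin (m + 1)) (p : Sym (Fin (m + 1)) d → R) : Matrix (Fin 5) (Fin 5) R :=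
  Matrix.of fun j l => p (padZero d [i, coord m j, coord m l])

/-- A polynomial whose nonvanishing characterizes the sums of five points in general position. -/
def genericity (p : Sym (Fin (m + 1)) d → R) : R :=
  (catMatrix p).det * (Matrix.of fun a b : Fin 5 =>
    ((catMatrixAt (coord m 1) p * (catMatrix p).adjugate) ^ ((a : ℕ) + b)).trace).det

theorem map_veroneseSum {S : Type*} [CommRing S] (f : R →+* S) (x : Fin 5 → Fin (m + 1) → R)
    (s : Sym (Fin (m + 1)) d) :
    f (veroneseSum m d x s) = veroneseSum m d (fun k i => f (x k i)) s := by
  simp only [veroneseSum, map_sum, map_multiset_prod, Multiset.map_map]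
  rfl

theorem map_genericity {S : Type*} [CommRing S] (f : R →+* S) (p : Sym (Fin (m + 1)) d → R) :
    f (genericity p) = genericity fun s => f (p s) := by
  have h1 : (catMatrix fun s => f (p s)) = f.mapMatrix (catMatrix p) := rfl
  have h2 : (catMatrixAt (coord m 1) fun s => f (p s)) =
    f.mapMatrix (catMatrixAt (coord m 1) p) := rfl
  rw [genericity, genericity, h1, h2, ← RingHom.map_adjugate, ← map_mul, map_mul f, RingHom.map_det,
    RingHom.map_det]
  congr 2
  ext a b
  simp only [RingHom.mapMatrix_apply, Matrix.map_apply, Matrix.of_apply, ← Matrix.map_pow,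
    AddMonoidHom.map_trace]

theorem veroneseSum_padZero {l : List (Fin (m + 1))} (hl : l.length ≤ d)
    (x : Fin 5 → Fin (m + 1) → R) :
    veroneseSum m d x (padZero d l) = ∑ k, x k 0 ^ (d - l.length) * (l.map (x k)).prod := by
  refine Finset.sum_congr rfl fun k _ => ?_
  simp [padZero, List.take_of_length_le hl]

/-- The first five coordinates of five points, as columns. -/
def pointMatrix (x : Fin 5 → Fin (m + 1) → R) : Matrix (Fin 5) (Fin 5) R :=
  Matrix.of fun j k => x k (coord m j)

theorem catMatrix_veroneseSum (hd : 3 ≤ d) (x : Fin 5 → Fin (m + 1) → R) :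
    catMatrix (veroneseSum m d x) = pointMatrix x * Matrix.diagonal (fun k => x k 0 ^ (d - 2)) *
      (pointMatrix x).transpose := by
  ext j l
  rw [catMatrix, Matrix.of_apply, veroneseSum_padZero (by simp; omega), Matrix.mul_apply]
  refine Finset.sum_congr rfl fun k _ => ?_
  simp [pointMatrix]
  ring

theorem catMatrixAt_veroneseSum (hd : 3 ≤ d) (i : Fin (m + 1)) (x : Fin 5 → Fin (m + 1) → R) :
    catMatrixAt i (veroneseSum m d x) = pointMatrix x *
      Matrix.diagonal (fun k => x k 0 ^ (d - 3) * x k i) * (pointMatrix x).transpose := by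
  ext j l
  rw [catMatrixAt, Matrix.of_apply, veroneseSum_padZero (by simp; omega), Matrix.mul_apply]
  refine Finset.sum_congr rfl fun k _ => ?_
  simp [pointMatrix]
  ring

end Catalecticant

section Field

variable {K : Type*} [Field K] {m d : ℕ} {x : Fin 5 → Fin (m + 1) → K}

theorem det_catMatrix_ne_zero_iff (hd : 3 ≤ d) :
    (catMatrix (veroneseSum m d x)).det ≠ 0 ↔ (pointMatrix x).det ≠ 0 ∧ ∀ k, x k 0 ≠ 0 := by
  rw [catMatrix_veroneseSum hd]
  simp only [Matrix.det_mul, Matrix.det_diagonal, Matrix.det_transpose, mul_ne_zero_iff,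
    Finset.prod_ne_zero_iff, Finset.mem_univ, true_implies, pow_ne_zero_iff (by omega : d - 2 ≠ 0)]
  tauto

/-- Both catalecticants are congruent to diagonal matrices through the same `pointMatrix`, so their
quotient is diagonalized by it, with eigenvalues `x k i / x k 0`. The adjugate replaces the inverse
to keep `genericity` polynomial, at the cost of the factor `det`. -/
theorem catMatrixAt_mul_adjugate (hd : 3 ≤ d) (h : (catMatrix (veroneseSum m d x)).det ≠ 0)
    (i : Fin (m + 1)) :
    catMatrixAt i (veroneseSum m d x) * (catMatrix (veroneseSum m d x)).adjugate =
      pointMatrix x * Matrix.diagonal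
        (fun k => (catMatrix (veroneseSum m d x)).det * (x k i / x k 0)) * (pointMatrix x)⁻¹ := by
  obtain ⟨h1, h2⟩ := (det_catMatrix_ne_zero_iff hd).1 h
  set A := catMatrix (veroneseSum m d x) with hA
  have hX : IsUnit (pointMatrix x).det := isUnit_iff_ne_zero.2 h1
  have h3 : catMatrixAt i (veroneseSum m d x) = pointMatrix x *
      Matrix.diagonal (fun k => x k i / x k 0) * (pointMatrix x)⁻¹ * A := by
    rw [hA, catMatrix_veroneseSum hd, catMatrixAt_veroneseSum hd]
    simp only [Matrix.mul_assoc]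
    rw [Matrix.nonsing_inv_mul_cancel_left _ _ hX, ← Matrix.mul_assoc (Matrix.diagonal _)
      (Matrix.diagonal _), Matrix.diagonal_mul_diagonal]
    congr 3
    ext k
    obtain ⟨e, rfl⟩ := Nat.exists_eq_add_of_le hd
    have := h2 k
    rw [show 3 + e - 2 = e + 1 by omega, show 3 + e - 3 = e by omega]
    field_simp
    ring
  rw [h3, Matrix.mul_assoc, Matrix.mul_adjugate, Matrix.mul_smul, Matrix.mul_one,
    ← Matrix.smul_mul, ← Matrix.mul_smul]
  congr 2
  ext a b
  simp [Matrix.diagonal_apply]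

/-- The traces of powers are the power sums of the eigenvalues, so their Hankel matrix is `Vᵀ * V`
with `V` Vandermonde, and its determinant is the discriminant. -/
theorem genericity_veroneseSum (hd : 3 ≤ d) (h : (catMatrix (veroneseSum m d x)).det ≠ 0) :
    genericity (veroneseSum m d x) = (catMatrix (veroneseSum m d x)).det *
      (Matrix.vandermonde fun k => (catMatrix (veroneseSum m d x)).det *
        (x k (coord m 1) / x k 0)).det ^ 2 := by
  have hX : IsUnit (pointMatrix x).det :=
    isUnit_iff_ne_zero.2 ((det_catMatrix_ne_zero_iff hd).1 h).1
  rw [genericity, catMatrixAt_mul_adjugate hd h, pow_two]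
  set v : Fin 5 → K := fun k => (catMatrix (veroneseSum m d x)).det *
        (x k (coord m 1) / x k 0)
  congr 1
  have hpow : ∀ n : ℕ, (pointMatrix x * Matrix.diagonal v * (pointMatrix x)⁻¹) ^ n =
      pointMatrix x * Matrix.diagonal v ^ n * (pointMatrix x)⁻¹ := by
    intro n
    induction n with
    | zero => simp [Matrix.mul_nonsing_inv _ hX]
    | succ n ih =>
      rw [pow_succ, ih, pow_succ]
      simp only [Matrix.mul_assoc]
      rw [Matrix.nonsing_inv_mul_cancel_left _ _ hX]
  have hg : (Matrix.of fun a b : Fin 5 => ((pointMatrix x * Matrix.diagonal v *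
      (pointMatrix x)⁻¹) ^ ((a : ℕ) + b)).trace) =
      (Matrix.vandermonde v).transpose * Matrix.vandermonde v := by
    ext a b
    rw [Matrix.of_apply, hpow, Matrix.trace_mul_comm, Matrix.nonsing_inv_mul_cancel_left _ _ hX,
      Matrix.diagonal_pow, Matrix.trace_diagonal, Matrix.mul_apply]
    simp [Matrix.vandermonde, pow_add]
  rw [hg, Matrix.det_mul, Matrix.det_transpose]

theorem det_catMatrix_ne_zero_of_genericity {p : Sym (Fin (m + 1)) d → K}
    (h : genericity p ≠ 0) : (catMatrix p).det ≠ 0 :=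
  left_ne_zero_of_mul h

theorem genericity_ne_zero_iff (hd : 3 ≤ d) :
    genericity (veroneseSum m d x) ≠ 0 ↔ (pointMatrix x).det ≠ 0 ∧ (∀ k, x k 0 ≠ 0) ∧
      Function.Injective fun k => x k (coord m 1) / x k 0 := by
  rw [← and_assoc, ← det_catMatrix_ne_zero_iff hd]
  constructor
  · intro h
    have h1 := det_catMatrix_ne_zero_of_genericity h
    refine ⟨h1, fun a b hab => ?_⟩
    rw [genericity_veroneseSum hd h1] at h
    refine Matrix.det_vandermonde_ne_zero_iff.1 (pow_ne_zero_iff two_ne_zero |>.1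
      (right_ne_zero_of_mul h)) ?_
    simp only at hab ⊢
    rw [hab]
  · rintro ⟨h1, h2⟩
    rw [genericity_veroneseSum hd h1]
    refine mul_ne_zero h1 (pow_ne_zero _ (Matrix.det_vandermonde_ne_zero_iff.2 fun a b hab => ?_))
    exact h2 (mul_left_cancel₀ h1 hab)

theorem linearIndependent_of_det_pointMatrix_ne_zero (h : (pointMatrix x).det ≠ 0) :
    LinearIndependent K x := by
  have h1 : LinearIndependent K (pointMatrix x).transpose :=
    Matrix.linearIndependent_rows_of_det_ne_zero (by rwa [Matrix.det_transpose])
  exact LinearIndependent.of_comp (LinearMap.funLeft K K (coord m)) h1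

end Field

/-! ### Local boundedness of the five points -/

section Bound

variable {m d : ℕ}

theorem continuous_catMatrix :
    Continuous (catMatrix : VeroneseSpace ℂ m d → Matrix (Fin 5) (Fin 5) ℂ) :=
  continuous_pi fun _ => continuous_pi fun _ => continuous_apply _

theorem continuous_catMatrixAt (i : Fin (m + 1)) :
    Continuous (catMatrixAt i : VeroneseSpace ℂ m d → Matrix (Fin 5) (Fin 5) ℂ) :=
  continuous_pi fun _ => continuous_pi fun _ => continuous_apply _

theorem continuous_genericity : Continuous (genericity : VeroneseSpace ℂ m d → ℂ) := by
  refine continuous_catMatrix.matrix_det.mul (Continuous.matrix_det ?_)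
  refine continuous_pi fun a => continuous_pi fun b => ?_
  exact (((continuous_catMatrixAt _).mul continuous_catMatrix.matrix_adjugate).pow _).matrix_trace

theorem norm_eigenvalue_le {T : Matrix (Fin 5) (Fin 5) ℂ} {v : Fin 5 → ℂ} (hv : v ≠ 0) {μ : ℂ}
    (h : T.mulVec v = μ • v) : ‖μ‖ ≤ ∑ j, ∑ l, ‖T j l‖ := by
  obtain ⟨j, -, hj⟩ := Finset.exists_max_image Finset.univ (fun j => ‖v j‖) ⟨0, by simp⟩
  have hpos : 0 < ‖v j‖ := by
    obtain ⟨l, hl⟩ := Function.ne_iff.1 hv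
    exact (norm_pos_iff.2 hl).trans_le (hj l (by simp))
  have h1 : ‖μ‖ * ‖v j‖ ≤ (∑ l, ‖T j l‖) * ‖v j‖ := by
    have h2 : ‖μ‖ * ‖v j‖ = ‖∑ l, T j l * v l‖ := by
      rw [← norm_mul]
      exact congrArg norm (congrFun h j).symm
    rw [h2, Finset.sum_mul]
    refine (norm_sum_le _ _).trans (Finset.sum_le_sum fun l _ => ?_)
    rw [norm_mul]
    exact mul_le_mul_of_nonneg_left (hj l (by simp)) (norm_nonneg _)
  refine (le_of_mul_le_mul_right h1 hpos).trans ?_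
  exact Finset.single_le_sum (f := fun j => ∑ l, ‖T j l‖)
    (fun j _ => Finset.sum_nonneg fun l _ => norm_nonneg _) (Finset.mem_univ j)

theorem norm_eigenvalue_catMatrixAt_le (hd : 3 ≤ d) {x : Fin 5 → Fin (m + 1) → ℂ}
    (h : (catMatrix (veroneseSum m d x)).det ≠ 0) (k : Fin 5) (i : Fin (m + 1)) :
    ‖(catMatrix (veroneseSum m d x)).det * (x k i / x k 0)‖ ≤ ∑ j, ∑ l,
      ‖(catMatrixAt i (veroneseSum m d x) * (catMatrix (veroneseSum m d x)).adjugate) j l‖ := by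
  obtain ⟨h1, h2⟩ := (det_catMatrix_ne_zero_iff hd).1 h
  have hX : IsUnit (pointMatrix x).det := isUnit_iff_ne_zero.2 h1
  refine norm_eigenvalue_le (v := (pointMatrix x).mulVec (Pi.single k 1)) (fun h0 => ?_) ?_
  · have := congrFun h0 0
    simp [pointMatrix] at this
    exact h2 k (by simpa [coord] using this)
  · rw [catMatrixAt_mul_adjugate hd h, Matrix.mulVec_mulVec, Matrix.mul_assoc,
      Matrix.nonsing_inv_mul _ hX, Matrix.mul_one, ← Matrix.mulVec_mulVec,
      Matrix.diagonal_mulVec_single, ← Matrix.mulVec_smul]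
    congr 1
    ext j
    by_cases hj : j = k
    · subst hj; simp
    · simp [hj]

/-- The five points are bounded near a sum of five points in general position. -/
theorem exists_norm_le (hd : 10 ≤ d) {p : VeroneseSpace ℂ m d} (hp : genericity p ≠ 0) :
    ∃ r > 0, ∃ M, ∀ x, veroneseSum m d x ∈ Metric.closedBall p r →
      genericity (veroneseSum m d x) ≠ 0 ∧ ‖x‖ ≤ M := by
  obtain ⟨r, hr, hball⟩ := Metric.nhds_basis_closedBall.mem_iff.1
    (continuous_genericity.isOpen_preimage _ isOpen_ne |>.mem_nhds hp)
  have hK := isCompact_closedBall p r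
  have hdet : ∀ q ∈ Metric.closedBall p r, (catMatrix q).det ≠ 0 := fun q hq =>
    det_catMatrix_ne_zero_of_genericity (hball hq)
  obtain ⟨M₁, hM₁⟩ := hK.exists_bound_of_continuousOn
    (f := fun q => ∑ i : Fin (m + 1), ∑ j, ∑ l,
      ‖(catMatrixAt i q * (catMatrix q).adjugate) j l‖) (Continuous.continuousOn (by
        refine continuous_finsetSum _ fun i _ => continuous_finsetSum _ fun j _ =>
          continuous_finsetSum _ fun l _ => continuous_norm.comp ?_
        exact ((continuous_catMatrixAt i).mul continuous_catMatrix.matrix_adjugate).matrix_elem j l))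
  -- The vector of coordinates at `x_0 ^ (d - a) * x_1 ^ a`, scaled by `δ ^ a`, is `Vᵀ` applied to
  -- the `x k 0 ^ d`. Applying the adjugate of `Vᵀ` gives `det V • x k 0 ^ d`, a continuous function
  -- of the point and the eigenvalues.
  obtain ⟨M₂, hM₂⟩ := (hK.prod (isCompact_closedBall (0 : Fin 5 → ℂ) M₁)).exists_bound_of_continuousOn
    (f := fun z : VeroneseSpace ℂ m d × (Fin 5 → ℂ) =>
      (Matrix.vandermonde z.2).transpose.adjugate.mulVec fun a : Fin 5 =>
        (catMatrix z.1).det ^ (a : ℕ) * z.1 (padZero d (List.replicate a (coord m 1))))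
    (Continuous.continuousOn (by
      have h1 : Continuous fun z : VeroneseSpace ℂ m d × (Fin 5 → ℂ) => Matrix.vandermonde z.2 :=
        continuous_pi fun i => continuous_pi fun j =>
          ((continuous_apply i).comp continuous_snd).pow _
      refine Continuous.matrix_mulVec h1.matrix_transpose.matrix_adjugate (continuous_pi fun a => ?_)
      exact ((continuous_catMatrix.comp continuous_fst).matrix_det.pow _).mul
        ((continuous_apply _).comp continuous_fst)))
  obtain ⟨M₃, hM₃⟩ := hK.exists_bound_of_continuousOn
    (f := fun q => (catMatrix q).det⁻¹) (continuous_catMatrix.matrix_det.continuousOn.inv₀ hdet)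
  obtain ⟨M₄, hM₄⟩ := hK.exists_bound_of_continuousOn
    (f := fun q => (catMatrix q).det * (genericity q)⁻¹)
    (continuous_catMatrix.matrix_det.continuousOn.mul
      (continuous_genericity.continuousOn.inv₀ fun q hq => hball hq))
  -- Write `x k i` as `(δ * x k i / x k 0) * δ⁻¹ * x k 0`. The first two factors are bounded by `M₁`
  -- and `M₃`. For the third, `M₂` bounds `det V * x k 0 ^ d` and `M₄` bounds `(det V ^ 2)⁻¹`, so
  -- `M₂ ^ 2 * M₄` bounds the square of `‖x k 0 ^ d‖`; the added ones pass from the square to the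
  -- number and from its `d`-th power to the base.
  refine ⟨r, hr, M₁ * M₃ * (M₂ ^ 2 * M₄ + 1 + 1), fun x hx => ⟨hball hx, ?_⟩⟩
  have hg : genericity (veroneseSum m d x) ≠ 0 := hball hx
  have hδ := hdet _ hx
  obtain ⟨-, hx0⟩ := (det_catMatrix_ne_zero_iff (by omega)).1 hδ
  have hgen := genericity_veroneseSum (by omega) hδ
  have b1 := hM₁ _ hx
  have b3 := hM₃ _ hx
  have b4 := hM₄ _ hx
  set q := veroneseSum m d x with hq
  set δ := (catMatrix q).det with hδdef
  have eig : ∀ k i, ‖δ * (x k i / x k 0)‖ ≤ M₁ := fun k i => by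
    refine (norm_eigenvalue_catMatrixAt_le (by omega) hδ k i).trans ?_
    refine le_trans ?_ ((Real.le_norm_self _).trans b1)
    exact Finset.single_le_sum (f := fun i : Fin (m + 1) => ∑ j : Fin 5, ∑ l : Fin 5,
      ‖(catMatrixAt i q * (catMatrix q).adjugate) j l‖)
      (fun j _ => Finset.sum_nonneg fun l _ => Finset.sum_nonneg fun l _ => norm_nonneg _)
      (Finset.mem_univ i)
  have hM₁0 : 0 ≤ M₁ := (norm_nonneg _).trans b1
  have hM₃0 : 0 ≤ M₃ := (norm_nonneg _).trans b3
  set μ : Fin 5 → ℂ := fun k => δ * (x k (coord m 1) / x k 0) with hμ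
  have b2 := hM₂ (q, μ) ⟨hx, by
    rw [mem_closedBall_zero_iff, pi_norm_le_iff_of_nonneg hM₁0]
    exact fun k => eig k _⟩
  have hM₂0 : 0 ≤ M₂ := (norm_nonneg _).trans b2
  have hw : (fun a : Fin 5 => δ ^ (a : ℕ) * q (padZero d (List.replicate a (coord m 1)))) =
      (Matrix.vandermonde μ).transpose.mulVec fun k => x k 0 ^ d := by
    ext a
    rw [hq, veroneseSum_padZero (by simp; omega), Finset.mul_sum]
    change _ = ∑ k, (Matrix.vandermonde μ).transpose a k * x k 0 ^ d
    refine Finset.sum_congr rfl fun k _ => ?_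
    have ha : x k 0 ^ d = x k 0 ^ (d - a) * x k 0 ^ (a : ℕ) := by
      rw [← pow_add]; congr 1; omega
    simp only [List.length_replicate, List.map_replicate, List.prod_replicate,
      Matrix.transpose_apply, Matrix.vandermonde_apply, hμ, ha, mul_pow, div_pow]
    have := pow_ne_zero (a : ℕ) (hx0 k)
    field_simp
  simp only at b2
  rw [← hδdef, hw, Matrix.mulVec_mulVec, Matrix.adjugate_mul, Matrix.smul_mulVec, Matrix.one_mulVec,
    Matrix.det_transpose] at b2
  have hW : (Matrix.vandermonde μ).det ≠ 0 := fun h0 => hg (by rw [hgen, h0]; ring)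
  have hc : ∀ k, ‖x k 0‖ ^ d ≤ M₂ ^ 2 * M₄ + 1 := by
    intro k
    have h1 : ‖(Matrix.vandermonde μ).det‖ * ‖x k 0 ^ d‖ ≤ M₂ := by
      rw [← norm_mul]
      exact (norm_le_pi_norm ((Matrix.vandermonde μ).det • fun k => x k 0 ^ d) k).trans b2
    have h2 : ‖(Matrix.vandermonde μ).det ^ 2‖⁻¹ ≤ M₄ := by
      rw [← norm_inv]
      refine le_trans (le_of_eq ?_) b4
      congr 1
      rw [hgen]
      field_simp
    have hWp := norm_pos_iff.2 hW
    have h3 : ‖x k 0 ^ d‖ ^ 2 ≤ M₂ ^ 2 * M₄ := by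
      calc ‖x k 0 ^ d‖ ^ 2 = (‖(Matrix.vandermonde μ).det‖ * ‖x k 0 ^ d‖) ^ 2 *
            ‖(Matrix.vandermonde μ).det ^ 2‖⁻¹ := by
              rw [norm_pow (Matrix.vandermonde μ).det]; field_simp
        _ ≤ M₂ ^ 2 * M₄ := by gcongr
    rw [← norm_pow]
    nlinarith [sq_nonneg (‖x k 0 ^ d‖ - 1)]
  have hx0' : ∀ k, ‖x k 0‖ ≤ M₂ ^ 2 * M₄ + 1 + 1 := by
    intro k
    rcases le_total ‖x k 0‖ 1 with h | h
    · have := (pow_nonneg (norm_nonneg (x k 0)) d).trans (hc k)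
      linarith
    · have := (le_self_pow₀ h (by omega : d ≠ 0)).trans (hc k)
      linarith
  have hc0 := (norm_nonneg _).trans (hx0' 0)
  rw [pi_norm_le_iff_of_nonneg (by positivity)]
  intro k
  rw [pi_norm_le_iff_of_nonneg (by positivity)]
  intro i
  have hxi : x k i = (δ * (x k i / x k 0)) * δ⁻¹ * x k 0 := by
    have := hx0 k
    field_simp
  rw [hxi, norm_mul, norm_mul]
  gcongr
  exacts [eig k i, hx0' k]

end Bound

/-! ### Sums of five points: existence, uniqueness, immersion -/

section Secant

variable {m d : ℕ}

theorem veroneseSum_eq_sum {K : Type} [Field K] (x : Fin 5 → Fin (m + 1) → K) :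
    veroneseSum m d x = ∑ k, veronese m d (x k) := by
  ext s
  rw [Finset.sum_apply]
  rfl

theorem inSpanOfPoints_five_iff (hd : 0 < d) {p : VeroneseSpace ℂ m d} :
    InSpanOfPoints m d 5 p ↔ p ∈ Set.range (veroneseSum m d) := by
  rw [inSpanOfPoints_iff]
  constructor
  · rintro ⟨x, a, rfl⟩
    choose γ hγ using fun k => IsAlgClosed.exists_pow_nat_eq (a k) hd
    exact ⟨fun k => γ k • x k, by simp only [veroneseSum_eq_sum, veronese_smul, hγ]⟩
  · rintro ⟨x, rfl⟩
    exact ⟨x, fun _ => 1, by simp [veroneseSum_eq_sum]⟩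

theorem secantCone_five (hd : 0 < d) :
    secantCone m d 5 = closure (Set.range (veroneseSum (R := ℂ) m d)) := by
  rw [secantCone]
  congr 1
  ext p
  exact inSpanOfPoints_five_iff hd

theorem contDiff_veroneseSum {n : WithTop ℕ∞} :
    ContDiff ℂ n (veroneseSum m d : (Fin 5 → Fin (m + 1) → ℂ) → VeroneseSpace ℂ m d) := by
  rw [contDiff_pi]
  intro s
  obtain ⟨f, hf⟩ := s.exists_fun
  simp only [veroneseSum, hf]
  refine ContDiff.sum fun k _ => contDiff_prod fun t _ => ?_
  fun_prop

theorem continuous_veroneseSum :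
    Continuous (veroneseSum m d : (Fin 5 → Fin (m + 1) → ℂ) → VeroneseSpace ℂ m d) :=
  (contDiff_veroneseSum (n := 0)).continuous

/-- Near `p` all presentations lie in one compact ball, whose image is closed. -/
theorem exists_veroneseSum_eq (hd : 10 ≤ d) {p : VeroneseSpace ℂ m d} (hp : p ∈ secantCone m d 5)
    (hg : genericity p ≠ 0) : ∃ x, veroneseSum m d x = p := by
  rw [secantCone_five (by omega)] at hp
  obtain ⟨r, hr, M, hM⟩ := exists_norm_le hd hg
  have hcl : IsClosed (veroneseSum m d '' Metric.closedBall (0 : Fin 5 → Fin (m + 1) → ℂ) M) :=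
    ((isCompact_closedBall _ _).image continuous_veroneseSum).isClosed
  have hmem : p ∈ closure (veroneseSum m d ''
      Metric.closedBall (0 : Fin 5 → Fin (m + 1) → ℂ) M) := by
    rw [Metric.mem_closure_iff] at hp ⊢
    intro ε hε
    obtain ⟨_, ⟨x, rfl⟩, hx⟩ := hp (min ε r) (lt_min hε hr)
    refine ⟨_, ⟨x, ?_, rfl⟩, hx.trans_le (min_le_left _ _)⟩
    rw [mem_closedBall_zero_iff]
    refine (hM x ?_).2
    rw [Metric.mem_closedBall, dist_comm]
    exact (hx.trans_le (min_le_right _ _)).le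
  rw [hcl.closure_eq] at hmem
  obtain ⟨x, -, hx⟩ := hmem
  exact ⟨x, hx⟩

/-- Uniqueness of the presentation as a sum of five points. -/
theorem exists_perm_of_veroneseSum_eq (hd : 10 ≤ d) {x y : Fin 5 → Fin (m + 1) → ℂ}
    (hy : LinearIndependent ℂ y) (h : veroneseSum m d x = veroneseSum m d y) :
    ∃ (σ : Equiv.Perm (Fin 5)) (α : Fin 5 → ℂ), ∀ k, α k ^ d = 1 ∧ y k = α k • x (σ k) := by
  rw [veroneseSum_eq_sum, veroneseSum_eq_sum] at h
  have hsep : ∀ k, Separates 1 (y k) (y '' {j | j ≠ k}) := fun k =>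
    Separates.of_notMem_span (hy.notMem_span_image (by simp))
  have h1 : ∀ k, ∃ j, ∃ α : ℂ, α • x j = y k := by
    intro k
    by_contra! hno
    -- If no `x j` is proportional to `y k`, five forms kill the `x j` one by one and a sixth kills
    -- the other `y j`.
    have h2 := Separates.of_pairs x (hy.ne_zero k) 5 Finset.univ ∅ (by simp) (by simp)
      (fun i _ hi => by
        obtain ⟨α, hα⟩ := Submodule.mem_span_singleton.1 hi
        exact hno i α hα) (by simp)
    have h3 := coeff_eq_zero_of_separates (d := d) (c := fun _ => 1) (a := fun _ => 1) (x := y)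
      (y := x) (by simpa using h.symm) k
      ((((hsep k).union h2).mono (by simp)).mono_degree (hy.ne_zero k) (by omega))
    simp at h3
  choose j α hα using h1
  have hα0 : ∀ k, α k ≠ 0 := fun k h0 => hy.ne_zero k (by rw [← hα k, h0, zero_smul])
  have hj : Function.Injective j := by
    intro k k' e
    by_contra hne
    refine hy.notMem_span_image (s := {k'}) (x := k) (by simpa using hne) ?_
    rw [Set.image_singleton, Submodule.mem_span_singleton]
    refine ⟨α k / α k', ?_⟩
    rw [← hα k, ← hα k', smul_smul, div_mul_cancel₀ _ (hα0 k'), e]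
  refine ⟨Equiv.ofBijective j (Finite.injective_iff_bijective.1 hj), α, fun k => ⟨?_, ?_⟩⟩
  · have hx : ∀ k, x (j k) = (α k)⁻¹ • y k := fun k => by
      rw [← hα k, smul_smul, inv_mul_cancel₀ (hα0 k), one_smul]
    have h4 : ∑ k, veronese m d (x k) = ∑ k, ((α k)⁻¹) ^ d • veronese m d (y k) := by
      rw [← Equiv.sum_comp (Equiv.ofBijective j (Finite.injective_iff_bijective.1 hj))]
      refine Finset.sum_congr rfl fun k _ => ?_
      rw [← veronese_smul, ← hx]
      rfl
    -- The difference of the two presentations is a relation among the `y k` alone.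
    have h5 := coeff_eq_zero_of_separates (d := d) (ι := Empty) (κ := Fin 5) (a := fun _ => 0)
      (y := fun _ => 0) (x := y) (c := fun k => (α k)⁻¹ ^ d - 1)
      (by simp only [sub_smul, one_smul, Finset.sum_sub_distrib, ← h4, h]; simp) k
      (((hsep k).mono (by rw [Set.range_eq_empty, Set.union_empty])).mono_degree (hy.ne_zero k)
        (by omega))
    rw [sub_eq_zero, inv_pow] at h5
    exact inv_eq_one.1 h5
  · exact (hα k).symm

/-- With `f` vanishing at every `x j` except `x k`, apply the functional of `l * f ^ (d - 1)` to a
derivative that is zero: only the `k`-th term survives. Taking `l = f` gives `f (v k) = 0`, and then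
`l` a coordinate gives `v k = 0`. -/
theorem fderiv_veroneseSum_injective (hd : 10 ≤ d) {x : Fin 5 → Fin (m + 1) → ℂ}
    (hx : LinearIndependent ℂ x) :
    Function.Injective (fderiv ℂ (veroneseSum m d : _ → VeroneseSpace ℂ m d) x) := by
  rw [injective_iff_map_eq_zero]
  intro v hv
  have hline : HasDerivAt (fun t : ℂ => veroneseSum m d (x + t • v))
      (0 : VeroneseSpace ℂ m d) 0 := by
    have h1 : HasFDerivAt (veroneseSum m d : _ → VeroneseSpace ℂ m d)
        (fderiv ℂ (veroneseSum m d : _ → VeroneseSpace ℂ m d) x) (x + (0 : ℂ) • v) := by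
      rw [zero_smul, add_zero]
      exact ((contDiff_veroneseSum (n := 1)).differentiable (by simp) x).hasFDerivAt
    have h2 : HasDerivAt (fun t : ℂ => x + t • v) v 0 := by
      simpa using ((hasDerivAt_id (0 : ℂ)).smul_const v).const_add x
    have := h1.comp_hasDerivAt (0 : ℂ) h2
    rwa [hv] at this
  obtain ⟨e, rfl⟩ : ∃ e, d = e + 1 := ⟨d - 1, by omega⟩
  funext k
  obtain ⟨f, hf, hf0⟩ := Submodule.exists_le_ker_of_notMem
    (hx.notMem_span_image (s := {j | j ≠ k}) (x := k) (by simp))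
  have hfj : ∀ j, j ≠ k → f (x j) = 0 := fun j hj =>
    hf0 (Submodule.subset_span ⟨j, hj, rfl⟩)
  have key : ∀ l : Module.Dual ℂ (Fin (m + 1) → ℂ),
      l (v k) * f (x k) ^ e + l (x k) * (e * f (x k) ^ (e - 1) * f (v k)) = 0 := by
    intro l
    obtain ⟨Λ, hΛ⟩ := exists_functional_veronese (Fin.cons l fun _ : Fin e => f)
    have h1 := (Λ.toContinuousLinearMap.hasFDerivAt (x := veroneseSum m (e + 1)
      (x + (0 : ℂ) • v))).comp_hasDerivAt (0 : ℂ) hline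
    have h2 : ∀ (g : Module.Dual ℂ (Fin (m + 1) → ℂ)) j,
        HasDerivAt (fun t : ℂ => g ((x + t • v) j)) (g (v j)) 0 := by
      intro g j
      simp only [Pi.add_apply, Pi.smul_apply, map_add, map_smul, smul_eq_mul]
      simpa using ((hasDerivAt_id (0 : ℂ)).mul_const (g (v j))).const_add (g (x j))
    have h3 := HasDerivAt.fun_sum (u := Finset.univ) fun j (_ : j ∈ Finset.univ) =>
      (h2 l j).mul ((h2 f j).pow e)
    have h4 : (Λ.toContinuousLinearMap ∘ fun t : ℂ => veroneseSum m (e + 1) (x + t • v)) =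
        fun t : ℂ => ∑ j, l ((x + t • v) j) * f ((x + t • v) j) ^ e := by
      ext t
      simp [veroneseSum_eq_sum, hΛ, Fin.prod_univ_succ]
    rw [h4] at h1
    have h5 := h1.unique h3
    rw [Finset.sum_eq_single k] at h5
    · simpa using h5.symm
    · intro j _ hj
      have he : e ≠ 0 := by omega
      have he' : e - 1 ≠ 0 := by omega
      simp [hfj j hj, he, he']
    · simp
  have hfv : f (v k) = 0 := by
    have h1 := key f
    have h2 : f (v k) * f (x k) ^ e * (1 + e) = 0 := by
      rw [← h1]
      have : f (x k) * f (x k) ^ (e - 1) = f (x k) ^ e := by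
        rw [← pow_succ']; congr 1; omega
      linear_combination (-(e : ℂ) * f (v k)) * this
    have h3 : (1 + e : ℂ) ≠ 0 := by
      rw [add_comm]; exact Nat.cast_add_one_ne_zero e
    simpa [h3, hf] using h2
  funext i
  simpa [hfv, hf] using key (LinearMap.proj i)

/-- An immersion between finite-dimensional spaces is locally, up to a linear projection of the
target, a homeomorphism. -/
theorem exists_openPartialHomeomorph_of_injective_fderiv {𝕜 E F : Type*} [RCLike 𝕜]
    [NormedAddCommGroup E] [NormedSpace 𝕜 E] [FiniteDimensional 𝕜 E] [NormedAddCommGroup F]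
    [NormedSpace 𝕜 F] [FiniteDimensional 𝕜 F] {f : E → F} {a : E} (hf : ContDiffAt 𝕜 1 f a)
    (hinj : Function.Injective (fderiv 𝕜 f a)) :
    ∃ (π : F →L[𝕜] E) (e : OpenPartialHomeomorph E E), a ∈ e.source ∧ ∀ t, e t = π (f t) := by
  obtain ⟨g, hg⟩ := LinearMap.exists_leftInverse_of_injective (fderiv 𝕜 f a : E →ₗ[𝕜] F)
    (LinearMap.ker_eq_bot.2 hinj)
  have : CompleteSpace E := FiniteDimensional.complete 𝕜 E
  set π := LinearMap.toContinuousLinearMap g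
  have h1 : HasStrictFDerivAt (fun t => π (f t))
      ((ContinuousLinearEquiv.refl 𝕜 E : E ≃L[𝕜] E) : E →L[𝕜] E) a := by
    have h2 := π.hasStrictFDerivAt.comp a (hf.hasStrictFDerivAt one_ne_zero)
    convert h2 using 1
    ext v
    exact (LinearMap.congr_fun hg v).symm
  exact ⟨π, h1.toOpenPartialHomeomorph _, h1.mem_toOpenPartialHomeomorph_source, fun t => rfl⟩

end Secant

/-! ### The nongeneric locus contains no manifold of full dimension -/

section Dimension

open MvPolynomial

/-- Given an algebraic relation between `g ≠ 0` and the `f i`, there is one which remains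
nontrivial after setting `g` to zero. -/
theorem exists_aeval_eq_zero_of_not_algebraicIndependent {k A σ : Type*} [Field k] [CommRing A]
    [IsDomain A] [Algebra k A] {f : σ → A} {g : A} (hg : g ≠ 0)
    (h : ¬ AlgebraicIndependent k fun o : Option σ => o.elim g f) :
    ∃ R : MvPolynomial (Option σ) k, aeval (fun o => o.elim g f) R = 0 ∧
      aeval (fun o => o.elim 0 (X : σ → MvPolynomial σ k)) R ≠ 0 := by
  rw [algebraicIndependent_iff] at h
  push Not at h
  obtain ⟨R, hR, hR0⟩ := h
  -- Divide the relation by the highest power of the variable of `g`; this is allowed because `g ≠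
  -- 0` in a domain.
  obtain ⟨q, hq, hdvd⟩ := Polynomial.exists_eq_pow_rootMultiplicity_mul_and_not_dvd
    (optionEquivLeft k σ R) ((EmbeddingLike.map_ne_zero_iff).2 hR0) 0
  refine ⟨(optionEquivLeft k σ).symm q, ?_, ?_⟩
  · have h1 := congrArg (optionEquivLeft k σ).symm hq
    rw [AlgEquiv.symm_apply_apply] at h1
    rw [h1, map_mul, map_pow] at hR
    have hX : (optionEquivLeft k σ).symm (Polynomial.X - Polynomial.C 0) = X none := by
      rw [AlgEquiv.symm_apply_eq]
      simp
    rw [hX, map_mul, map_pow, aeval_X] at hR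
    exact (mul_eq_zero.1 hR).resolve_left (pow_ne_zero _ hg)
  · intro h0
    apply hdvd
    rw [Polynomial.dvd_iff_isRoot, Polynomial.IsRoot]
    have h2 : aeval (fun o => o.elim 0 (X : σ → MvPolynomial σ k)) =
        ((Polynomial.aeval (R := MvPolynomial σ k) 0).restrictScalars k).comp
          (optionEquivLeft k σ).toAlgHom := by
      refine algHom_ext fun o => ?_
      cases o <;> simp
    have h3 := DFunLike.congr_fun h2 ((optionEquivLeft k σ).symm q)
    rw [h0] at h3
    simpa [Polynomial.aeval_def] using h3.symm

theorem continuous_aeval {T σ : Type*} [TopologicalSpace T] {v : T → σ → ℂ} (hv : Continuous v)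
    (R : MvPolynomial σ ℝ) : Continuous fun t => aeval (v t) R := by
  induction R using MvPolynomial.induction_on with
  | C a => simpa using continuous_const
  | add p q hp hq => simp only [map_add]; exact hp.add hq
  | mul_X p i hp => simp only [map_mul, aeval_X]; exact hp.mul ((continuous_apply i).comp hv)

variable {m d : ℕ}

/-- Five points on the rational normal curve. -/
theorem genericity_moment_ne_zero {K : Type*} [Field K] (hm : 4 ≤ m) (hd : 3 ≤ d) {μ : Fin 5 → K}
    (hμ : Function.Injective μ) :
    genericity (veroneseSum m d fun k i => μ k ^ (i : ℕ)) ≠ 0 := by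
  have hc : ∀ j : Fin 5, ((coord m j : Fin (m + 1)) : ℕ) = j := fun j => by
    simp only [coord, Fin.val_ofNat]
    exact Nat.mod_eq_of_lt (by omega)
  rw [genericity_ne_zero_iff hd]
  refine ⟨?_, by simp, ?_⟩
  · have : pointMatrix (fun k (i : Fin (m + 1)) => μ k ^ (i : ℕ)) =
        (Matrix.vandermonde μ).transpose := by
      ext j k
      simp [pointMatrix, hc, Matrix.vandermonde_apply]
    rw [this, Matrix.det_transpose]
    exact Matrix.det_vandermonde_ne_zero_iff.2 hμ
  · simpa [hc] using hμ

/-- On the parameter space of five points, `genericity` and the coordinates of `π` are `5 * (m + 1)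
+ 1` polynomials in `5 * (m + 1)` variables, hence dependent. A relation not divisible by the first
variable extends to the closure by continuity, and restricts to a nonzero one where `genericity`
vanishes. -/
theorem exists_relation_of_genericity_eq_zero (hm : 4 ≤ m) (hd : 10 ≤ d)
    (π : VeroneseSpace ℝ m d →L[ℝ] EuclideanSpace ℝ (Fin (5 * (m + 1)))) :
    ∃ Q : MvPolynomial (Fin (5 * (m + 1))) ℝ, Q ≠ 0 ∧
      ∀ p ∈ realSecantCone m d 5, genericity p = 0 → eval (fun i => π p i) Q = 0 := by
  classical
  set X' : Fin 5 → Fin (m + 1) → MvPolynomial (Fin 5 × Fin (m + 1)) ℝ := fun k i => X (k, i)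
  set g := genericity (veroneseSum m d X')
  set f : Fin (5 * (m + 1)) → MvPolynomial (Fin 5 × Fin (m + 1)) ℝ := fun i =>
    ∑ s, C (π (Pi.single s 1) i) * veroneseSum m d X' s
  have hg : g ≠ 0 := by
    intro h
    have h1 := map_genericity (eval fun z : Fin 5 × Fin (m + 1) => ((z.1 : ℕ) : ℝ) ^ (z.2 : ℕ))
      (veroneseSum m d X')
    change eval _ g = _ at h1
    rw [h, map_zero] at h1
    refine genericity_moment_ne_zero (d := d) (μ := fun k : Fin 5 => ((k : ℕ) : ℝ)) hm (by omega)
      (fun a b hab => Fin.ext (Nat.cast_injective hab)) ?_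
    rw [h1]
    congr 1
    ext s
    rw [map_veroneseSum]
    simp [X']
  have hdep : ¬ AlgebraicIndependent ℝ fun o : Option (Fin (5 * (m + 1))) => o.elim g f := by
    intro h
    have := h.cardinalMk_le_trdeg
    rw [MvPolynomial.trdeg_of_isDomain] at this
    simp only [Cardinal.mk_fintype, Fintype.card_option, Fintype.card_fin, Fintype.card_prod,
      Cardinal.lift_natCast, Nat.cast_le] at this
    omega
  obtain ⟨R, hR, hR0⟩ := exists_aeval_eq_zero_of_not_algebraicIndependent hg hdep
  refine ⟨_, hR0, fun p hp hgp => ?_⟩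
  set v : VeroneseSpace ℂ m d → Option (Fin (5 * (m + 1))) → ℂ := fun q o =>
    o.elim (genericity q) fun i => ∑ s, ((π (Pi.single s 1) i : ℝ) : ℂ) * q s with hv
  have hvc : Continuous v := by
    refine continuous_pi fun o => ?_
    cases o with
    | none => exact continuous_genericity
    | some i => exact continuous_finsetSum _ fun s _ => continuous_const.mul (continuous_apply s)
  have hzero : ∀ q ∈ secantCone m d 5, aeval (v q) R = 0 := by
    rw [secantCone_five (by omega)]
    refine fun q hq => closure_minimal (t := {q | aeval (v q) R = 0}) ?_
      (isClosed_eq (continuous_aeval hvc R) continuous_const) hq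
    rintro _ ⟨x, rfl⟩
    have h1 := congrArg (aeval (R := ℝ) fun z : Fin 5 × Fin (m + 1) => x z.1 z.2) hR
    rw [map_zero, MvPolynomial.comp_aeval_apply] at h1
    change aeval _ R = 0
    rw [← h1]
    congr 2
    have h2 : ∀ s, aeval (R := ℝ) (fun z : Fin 5 × Fin (m + 1) => x z.1 z.2)
        (veroneseSum m d X' s) = veroneseSum m d x s := by
      intro s
      have := map_veroneseSum (aeval (R := ℝ)
        (fun z : Fin 5 × Fin (m + 1) => x z.1 z.2)).toRingHom X' s
      simpa [X'] using this
    funext o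
    cases o with
    | none =>
      have := map_genericity (aeval (R := ℝ)
        (fun z : Fin 5 × Fin (m + 1) => x z.1 z.2)).toRingHom (veroneseSum m d X')
      simp only [AlgHom.toRingHom_eq_coe, RingHom.coe_coe, h2] at this
      exact this.symm
    | some i => simp [hv, f, h2]
  have h3 := hzero _ hp.2
  have hgc : genericity (fun s => (p s : ℂ)) = 0 := by
    have := map_genericity Complex.ofRealHom p
    rw [hgp, map_zero] at this
    exact this.symm
  have hπ : ∀ i, π p i = ∑ s, π (Pi.single s 1) i * p s := by
    intro i
    conv_lhs => rw [← Finset.univ_sum_single p]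
    rw [map_sum]
    have : ∀ s, Pi.single s (p s) = p s • (Pi.single s 1 : VeroneseSpace ℝ m d) := by
      intro s
      rw [← Pi.single_smul, smul_eq_mul, mul_one]
    simp only [this, map_smul, WithLp.ofLp_sum, Finset.sum_apply, PiLp.smul_apply, smul_eq_mul]
    exact Finset.sum_congr rfl fun s _ => mul_comm _ _
  have h4 : v (fun s => (p s : ℂ)) = fun o => ((o.elim 0 fun i => π p i : ℝ) : ℂ) := by
    funext o
    cases o with
    | none => simp [hv, hgc]
    | some i => simp [hv, hπ]
  rw [h4] at h3
  have h5 : ((aeval (fun o : Option (Fin (5 * (m + 1))) => (o.elim 0 fun i => π p i : ℝ)) R : ℝ) : ℂ)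
      = 0 := by
    rw [← h3]
    exact MvPolynomial.comp_aeval_apply _ Complex.ofRealAm R
  have h6 : aeval (fun o : Option (Fin (5 * (m + 1))) => (o.elim 0 fun i => π p i : ℝ)) R = 0 := by
    exact_mod_cast h5
  rw [← coe_aeval_eq_eval, RingHom.coe_coe, MvPolynomial.comp_aeval_apply, ← h6]
  congr 2
  funext o
  cases o <;> simp

theorem MvPolynomial.eq_zero_of_isOpen {n : ℕ} {Q : MvPolynomial (Fin n) ℝ}
    {V : Set (EuclideanSpace ℝ (Fin n))} (hV : IsOpen V) (hne : V.Nonempty)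
    (h : ∀ v ∈ V, eval (fun i => v i) Q = 0) : Q = 0 := by
  obtain ⟨v, hv⟩ := hne
  have h1 : IsOpen {u : Fin n → ℝ | WithLp.toLp 2 u ∈ V} :=
    hV.preimage (PiLp.continuous_toLp 2 _)
  obtain ⟨r, hr, hball⟩ := Metric.isOpen_iff.1 h1 (fun i => v i) hv
  rw [ball_pi _ hr] at hball
  refine funext_set (fun i => Metric.ball (v i) r) (fun i => ?_) fun u hu => ?_
  · rw [Real.ball_eq_Ioo]
    exact Set.Ioo_infinite (by linarith)
  · rw [map_zero]
    exact h _ (hball hu)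

/-- A manifold of the right dimension in the real secant variety has points in general
position. -/
theorem exists_genericity_ne_zero (hm : 4 ≤ m) (hd : 10 ≤ d) {U : Set (VeroneseSpace ℝ m d)}
    (hU : IsSubmanifoldOfDim (5 * (m + 1)) U) (hne : U.Nonempty) (hsub : U ⊆ realSecantCone m d 5) :
    ∃ p ∈ U, genericity p ≠ 0 := by
  by_contra! hno
  obtain ⟨p, hp⟩ := hne
  obtain ⟨W, -, hpW, Ω, φ, hΩ, hφ, hinj, -, himg⟩ := hU p hp
  obtain ⟨t, ht, -⟩ : p ∈ φ '' Ω := himg ▸ ⟨hp, hpW⟩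
  have hφt : ContDiffAt ℝ 1 φ t := (hφ.contDiffAt (hΩ.mem_nhds ht)).of_le (by exact_mod_cast le_top)
  obtain ⟨π, e, hte, he⟩ := exists_openPartialHomeomorph_of_injective_fderiv hφt (hinj t ht)
  obtain ⟨Q, hQ, hQ0⟩ := exists_relation_of_genericity_eq_zero hm hd π
  -- `π ∘ φ` is a local homeomorphism, so the image of the manifold contains an open set on which
  -- `Q` would vanish.
  refine hQ (MvPolynomial.eq_zero_of_isOpen
    (e.isOpen_image_of_subset_source (e.open_source.inter hΩ) Set.inter_subset_left)
    ⟨_, t, ⟨hte, ht⟩, rfl⟩ ?_)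
  rintro _ ⟨t', ht', rfl⟩
  have : φ t' ∈ U := (himg ▸ Set.mem_image_of_mem φ ht'.2 : φ t' ∈ U ∩ W).1
  rw [he]
  exact hQ0 _ (hsub this) (hno _ this)

end Dimension

/-! ### Real rank of generic real points -/

section RealPoints

variable {m d : ℕ}

theorem star_veroneseSum (x : Fin 5 → Fin (m + 1) → ℂ) (s : Sym (Fin (m + 1)) d) :
    star (veroneseSum m d x s) = veroneseSum m d (star x) s :=
  map_veroneseSum (starRingEnd ℂ) x s

theorem genericity_ofReal (p : VeroneseSpace ℝ m d) :
    genericity (fun s => (p s : ℂ)) = (genericity p : ℝ) :=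
  (map_genericity Complex.ofRealHom p).symm

theorem linearIndependent_of_genericity_ne_zero (hd : 3 ≤ d) {x : Fin 5 → Fin (m + 1) → ℂ}
    (h : genericity (veroneseSum m d x) ≠ 0) : LinearIndependent ℂ x :=
  linearIndependent_of_det_pointMatrix_ne_zero ((genericity_ne_zero_iff hd).1 h).1

theorem exists_hasRank_of_genericity_ne_zero (hd : 10 ≤ d) {p : VeroneseSpace ℝ m d}
    (hp : p ∈ realSecantCone m d 5) (hg : genericity p ≠ 0) :
    ∃ r ∈ ({5, d + 3, 2 * d + 1} : Set ℕ), HasRank m d p r := by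
  have hg' : genericity (fun s => (p s : ℂ)) ≠ 0 := by
    rw [genericity_ofReal]
    exact_mod_cast hg
  obtain ⟨x, hx⟩ := exists_veroneseSum_eq hd hp.2 hg'
  rw [← hx] at hg'
  obtain ⟨-, hx0, -⟩ := (genericity_ne_zero_iff (by omega)).1 hg'
  have hli := linearIndependent_of_genericity_ne_zero (by omega) hg'
  have hstar : veroneseSum m d (star x) = veroneseSum m d x := by
    ext s
    rw [← star_veroneseSum, hx]
    exact Complex.conj_ofReal _
  obtain ⟨σ, α, hσ⟩ := exists_perm_of_veroneseSum_eq hd hli hstar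
  -- Scaling the zeroth coordinates to one removes the roots of unity from the uniqueness statement,
  -- so that conjugation permutes the vectors themselves.
  have hy : LinearIndependent ℂ fun k => (x k 0)⁻¹ • x k :=
    hli.units_smul fun k => (Units.mk0 (x k 0) (hx0 k))⁻¹
  refine exists_hasRank hd hy (c := fun k => x k 0 ^ d) (fun k => pow_ne_zero _ (hx0 k)) ?_ σ.symm
    fun k => ?_
  · rw [← hx, veroneseSum_eq_sum]
    refine Finset.sum_congr rfl fun k _ => ?_
    rw [← veronese_smul, smul_smul, mul_inv_cancel₀ (hx0 k), one_smul]
  · have h1 := (hσ (σ.symm k)).2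
    rw [Equiv.apply_symm_apply] at h1
    have hα : α (σ.symm k) ≠ 0 := fun h0 => hli.ne_zero (σ.symm k) (by rw [h1, h0, zero_smul])
    have h2 := hx0 k
    ext i
    have h3 : x (σ.symm k) 0 = α (σ.symm k) * star (x k 0) := congrFun h1 0
    have h4 : x (σ.symm k) i = α (σ.symm k) * star (x k i) := congrFun h1 i
    have h5 : star (x k 0) ≠ 0 := star_ne_zero.2 h2
    simp only [Pi.star_apply, Pi.smul_apply, smul_eq_mul, h3, h4, star_mul', star_inv₀]
    field_simp

end RealPoints

/-! ### Charts of the real locus -/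

section Chart

open Filter Topology

variable {m d : ℕ}

/-- A linear parametrization of the real form of the space of five points defined by an
involution. -/
theorem exists_realForm (m : ℕ) {τ : Equiv.Perm (Fin 5)} (hτ : ∀ k, τ (τ k) = k) :
    ∃ J : EuclideanSpace ℝ (Fin (5 * (m + 1))) →L[ℝ] (Fin 5 → Fin (m + 1) → ℂ),
      Function.Injective J ∧ ∀ x, x ∈ Set.range J ↔ ∀ k, star (x k) = x (τ k) := by
  -- The parameter is `t k = Re (x k) + Im (x k)`. As `x (τ k)` is the conjugate of `x k`, `t (τ k)
  -- = Re (x k) - Im (x k)`, and the formula recovers `x k`.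
  let J₀ : (Fin 5 → Fin (m + 1) → ℝ) →ₗ[ℝ] (Fin 5 → Fin (m + 1) → ℂ) :=
    { toFun := fun t k i => ((1 + Complex.I) * t k i + (1 - Complex.I) * t (τ k) i) / 2
      map_add' := fun t t' => by ext k i; simp; ring
      map_smul' := fun c t => by ext k i; simp; ring }
  have hJ₀ : ∀ t k i, J₀ t k i =
      ((1 + Complex.I) * t k i + (1 - Complex.I) * t (τ k) i) / 2 := fun _ _ _ => rfl
  have hre : ∀ t k i, (J₀ t k i).re + (J₀ t k i).im = t k i := by
    intro t k i
    have : J₀ t k i = ((t k i + t (τ k) i) / 2 : ℝ) + ((t k i - t (τ k) i) / 2 : ℝ) * Complex.I := by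
      rw [hJ₀]; push_cast; ring
    rw [this, Complex.add_re, Complex.add_im, Complex.re_ofReal_mul, Complex.im_ofReal_mul,
      Complex.ofReal_re, Complex.ofReal_im, Complex.I_re, Complex.I_im]
    ring
  let L : EuclideanSpace ℝ (Fin (5 * (m + 1))) ≃L[ℝ] (Fin 5 → Fin (m + 1) → ℝ) :=
    ContinuousLinearEquiv.ofFinrankEq (by simp [Module.finrank_pi_fintype])
  refine ⟨(LinearMap.toContinuousLinearMap J₀).comp
    (L : EuclideanSpace ℝ (Fin (5 * (m + 1))) →L[ℝ] (Fin 5 → Fin (m + 1) → ℝ)), ?_, fun x => ⟨?_, fun h => ?_⟩⟩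
  · refine Function.Injective.comp (g := J₀) (fun t t' h => ?_) L.injective
    funext k i
    rw [← hre t, h, hre]
  · rintro ⟨t, rfl⟩ k
    ext i
    change star (J₀ (L t) k i) = J₀ (L t) (τ k) i
    rw [hJ₀, hJ₀, hτ]
    simp
    ring
  · refine ⟨L.symm fun k i => (x k i).re + (x k i).im, ?_⟩
    funext k i
    change J₀ (L (L.symm _)) k i = _
    rw [L.apply_symm_apply, hJ₀, ← h k, Pi.star_apply]
    simp
    linear_combination Complex.re_add_im (x k i)

/-- The chart of the real locus given by a parametrization `J` of a real form. -/
noncomputable def realChart (d : ℕ)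
    (J : EuclideanSpace ℝ (Fin (5 * (m + 1))) →L[ℝ] (Fin 5 → Fin (m + 1) → ℂ))
    (t : EuclideanSpace ℝ (Fin (5 * (m + 1)))) : VeroneseSpace ℝ m d :=
  fun s => (veroneseSum m d (J t) s).re

variable {τ : Equiv.Perm (Fin 5)}
  {J : EuclideanSpace ℝ (Fin (5 * (m + 1))) →L[ℝ] (Fin 5 → Fin (m + 1) → ℂ)}

theorem veroneseSum_comp_perm {R : Type*} [CommRing R] (x : Fin 5 → Fin (m + 1) → R)
    (σ : Equiv.Perm (Fin 5)) : veroneseSum m d (fun k => x (σ k)) = veroneseSum m d x :=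
  funext fun s => Equiv.sum_comp σ fun k => ((s : Multiset (Fin (m + 1))).map (x k)).prod

/-- Conjugating the points only permutes them, so the sum is already real and the real part in
`realChart` loses nothing. -/
theorem ofReal_realChart (hJ : ∀ x, x ∈ Set.range J ↔ ∀ k, star (x k) = x (τ k))
    (t : EuclideanSpace ℝ (Fin (5 * (m + 1)))) :
    (fun s => (realChart d J t s : ℂ)) = veroneseSum m d (J t) := by
  funext s
  have h1 : star (J t) = fun k => J t (τ k) := funext ((hJ (J t)).1 ⟨t, rfl⟩)
  apply Complex.conj_eq_iff_re.1
  have := star_veroneseSum (J t) s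
  rw [h1, veroneseSum_comp_perm] at this
  exact this

theorem contDiff_realChart {n : WithTop ℕ∞} : ContDiff ℝ n (realChart d J) := by
  rw [contDiff_pi]
  intro s
  have h1 := (contDiff_pi.1 (contDiff_veroneseSum (m := m) (d := d) (n := n)) s).restrict_scalars ℝ
  exact Complex.reCLM.contDiff.comp (h1.comp J.contDiff)

theorem fderiv_realChart_injective (hd : 10 ≤ d) (hJi : Function.Injective J)
    (hJ : ∀ x, x ∈ Set.range J ↔ ∀ k, star (x k) = x (τ k))
    {t : EuclideanSpace ℝ (Fin (5 * (m + 1)))} (ht : LinearIndependent ℂ (J t)) :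
    Function.Injective (fderiv ℝ (realChart d J) t) := by
  rw [injective_iff_map_eq_zero]
  intro v hv
  let c : VeroneseSpace ℝ m d →L[ℝ] VeroneseSpace ℂ m d :=
    ContinuousLinearMap.pi fun s => Complex.ofRealCLM.comp (ContinuousLinearMap.proj s)
  have h1 := (c.hasFDerivAt (x := realChart d J t)).comp t
    ((contDiff_realChart (n := 1)).differentiable (by simp) t).hasFDerivAt
  have h2 := (((contDiff_veroneseSum (d := d) (n := 1)).differentiable (by simp)
    (J t)).hasFDerivAt.restrictScalars ℝ).comp t J.hasFDerivAt
  have h3 : (c ∘ realChart d J : _ → VeroneseSpace ℂ m d) = veroneseSum m d ∘ J :=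
    funext fun t => ofReal_realChart hJ t
  rw [h3] at h1
  have h4 := DFunLike.congr_fun (h1.unique h2) v
  simp only [ContinuousLinearMap.comp_apply, hv, map_zero] at h4
  refine hJi ?_
  rw [map_zero]
  refine fderiv_veroneseSum_injective hd ht ?_
  rw [map_zero]
  exact h4.symm

/-- The charts are open maps to the real locus. -/
theorem image_realChart_mem_nhdsWithin (hd : 10 ≤ d) (hJi : Function.Injective J)
    (hJ : ∀ x, x ∈ Set.range J ↔ ∀ k, star (x k) = x (τ k))
    {t : EuclideanSpace ℝ (Fin (5 * (m + 1)))} (ht : genericity (veroneseSum m d (J t)) ≠ 0)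
    {N : Set (EuclideanSpace ℝ (Fin (5 * (m + 1))))} (hN : N ∈ 𝓝 t) :
    realChart d J '' N ∈ 𝓝[realSecantCone m d 5] (realChart d J t) := by
  -- Take points of the real locus outside the image that converge to the chart point. By
  -- boundedness their presentations subconverge, and by uniqueness the limit is `J t` up to order
  -- and roots of unity.
  by_contra hcon
  obtain ⟨u, hu, huN⟩ := exists_seq_forall_of_frequently (l := 𝓝[realSecantCone m d 5]
    (realChart d J t)) (p := fun q => q ∉ realChart d J '' N)
    fun h => hcon (h.mono fun q hq => not_not.1 hq)
  obtain ⟨r, hr, M, hM⟩ := exists_norm_le hd ht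
  rw [tendsto_nhdsWithin_iff] at hu
  have hofReal : Continuous fun (q : VeroneseSpace ℝ m d) s => (q s : ℂ) := by fun_prop
  have hlim : Tendsto (fun n s => (u n s : ℂ)) atTop (𝓝 (veroneseSum m d (J t))) := by
    rw [← ofReal_realChart hJ]
    exact (hofReal.tendsto _).comp hu.1
  have hlim' := hlim.eventually (Metric.closedBall_mem_nhds _ hr)
  have hlim'' := hlim.eventually (continuous_genericity.isOpen_preimage _ isOpen_ne |>.mem_nhds ht)
  obtain ⟨n₀, hn₀⟩ := eventually_atTop.1 ((hu.2.and hlim').and hlim'')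
  have hex : ∀ n, ∃ x, veroneseSum m d x = (fun s => (u (n + n₀) s : ℂ)) ∧
      x ∈ Metric.closedBall (0 : Fin 5 → Fin (m + 1) → ℂ) M := by
    intro n
    obtain ⟨⟨h1, h2⟩, h3⟩ := hn₀ (n + n₀) (by omega)
    obtain ⟨x, hx⟩ := exists_veroneseSum_eq hd h1.2 h3
    exact ⟨x, hx, mem_closedBall_zero_iff.2 (hM x (by rw [hx]; exact h2)).2⟩
  choose x hx hxM using hex
  obtain ⟨a, -, φ, hφ, ha⟩ := (isCompact_closedBall _ _).tendsto_subseq hxM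
  have hφlim : Tendsto (fun n => φ n + n₀) atTop atTop :=
    tendsto_atTop_mono (fun n => Nat.le_add_right _ _) hφ.tendsto_atTop
  have hψ : veroneseSum m d a = veroneseSum m d (J t) := by
    refine tendsto_nhds_unique ((continuous_veroneseSum.tendsto a).comp ha) ?_
    refine (hlim.comp hφlim).congr fun n => ?_
    exact (hx (φ n)).symm
  have hli := linearIndependent_of_genericity_ne_zero (by omega) ht
  obtain ⟨σ, α, hσ⟩ := exists_perm_of_veroneseSum_eq hd hli hψ
  -- Correcting the order and the roots of unity keeps the sums and makes the presentations converge
  -- to `J t` itself.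
  set y : ℕ → Fin 5 → Fin (m + 1) → ℂ := fun n k => α k • x (φ n) (σ k) with hy
  have hylim : Tendsto y atTop (𝓝 (J t)) := by
    rw [show J t = fun k => α k • a (σ k) from funext fun k => (hσ k).2, tendsto_pi_nhds]
    exact fun k => (tendsto_pi_nhds.1 ha (σ k)).const_smul (α k)
  have hyψ : ∀ n, veroneseSum m d (y n) = fun s => (u (φ n + n₀) s : ℂ) := by
    intro n
    rw [← hx (φ n), ← veroneseSum_comp_perm (x (φ n)) σ, veroneseSum_eq_sum, veroneseSum_eq_sum]
    refine Finset.sum_congr rfl fun k _ => ?_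
    rw [hy, veronese_smul, (hσ k).1, one_smul]
  -- The conjugate presentation, reordered by `τ`, has the same sum and the same limit. Local
  -- injectivity at `J t` forces `z n = y n` eventually, which places `y n` in the real form.
  set z : ℕ → Fin 5 → Fin (m + 1) → ℂ := fun n k => star (y n (τ k)) with hz
  have hJt := (hJ (J t)).1 ⟨t, rfl⟩
  have hzlim : Tendsto z atTop (𝓝 (J t)) := by
    have h1 : J t = fun k => star (J t (τ k)) := funext fun k => by
      rw [← hJt k, star_star]
    rw [h1, tendsto_pi_nhds]
    exact fun k => (continuous_star.tendsto _).comp (tendsto_pi_nhds.1 hylim (τ k))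
  have hzψ : ∀ n, veroneseSum m d (z n) = veroneseSum m d (y n) := by
    intro n
    have h1 : z n = fun k => (star (y n)) (τ k) := rfl
    rw [h1, veroneseSum_comp_perm]
    ext s
    rw [← star_veroneseSum, hyψ]
    exact Complex.conj_ofReal _
  obtain ⟨π, e, he, heπ⟩ := exists_openPartialHomeomorph_of_injective_fderiv
    (contDiff_veroneseSum (m := m) (d := d)).contDiffAt (fderiv_veroneseSum_injective hd hli)
  have hsrc := e.open_source.mem_nhds he
  have hmem : ∀ᶠ n in atTop, y n ∈ Set.range J := by
    filter_upwards [hylim.eventually hsrc, hzlim.eventually hsrc] with n h1 h2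
    have h3 : z n = y n := e.injOn h2 h1 (by rw [heπ, heπ, hzψ])
    rw [hJ]
    intro k
    rw [← congrFun h3 k]
    exact star_star _
  have hemb : IsEmbedding J := (LinearMap.isClosedEmbedding_of_injective
    (LinearMap.ker_eq_bot.2 hJi)).isEmbedding
  obtain ⟨n₁, hn₁⟩ := eventually_atTop.1 hmem
  choose! w hw using hn₁
  have hwlim : Tendsto w atTop (𝓝 t) := by
    rw [hemb.tendsto_nhds_iff]
    refine hylim.congr' ?_
    filter_upwards [eventually_ge_atTop n₁] with n hn
    exact (hw n hn).symm
  obtain ⟨n, hn, hnN⟩ := ((eventually_ge_atTop n₁).and (hwlim.eventually hN)).exists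
  refine huN (φ n + n₀) ⟨w n, hnN, ?_⟩
  ext s
  apply Complex.ofReal_injective
  have h1 := congrFun (ofReal_realChart (d := d) hJ (w n)) s
  rw [hw n hn, hyψ] at h1
  exact h1

theorem genericity_zero {R : Type*} [CommRing R] :
    genericity (0 : Sym (Fin (m + 1)) d → R) = 0 := by
  have : catMatrix (0 : Sym (Fin (m + 1)) d → R) = 0 := rfl
  rw [genericity, this, Matrix.det_zero, zero_mul]

/-- The neighbourhood is the image of a small ball around five points of the moment curve, whose
nodes `μ` have the prescribed conjugation pattern. -/
theorem isTypicalRank_of_perm (hm : 4 ≤ m) (hd : 10 ≤ d) (hτ : ∀ k, τ (τ k) = k) {μ : Fin 5 → ℂ}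
    (hμ : Function.Injective μ) (hμτ : ∀ k, star (μ k) = μ (τ k)) {r : ℕ}
    (hr : ∀ (p : VeroneseSpace ℝ m d) (x : Fin 5 → Fin (m + 1) → ℂ), LinearIndependent ℂ x →
      (∀ k, star (x k) = x (τ k)) → (fun s => (p s : ℂ)) = veroneseSum m d x → HasRank m d p r) :
    IsTypicalRank m d 5 r := by
  obtain ⟨J, hJi, hJ⟩ := exists_realForm m hτ
  obtain ⟨t, ht⟩ : (fun k (i : Fin (m + 1)) => μ k ^ (i : ℕ)) ∈ Set.range J := by
    rw [hJ]
    intro k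
    ext i
    simp [← hμτ]
  have hgt : genericity (veroneseSum m d (J t)) ≠ 0 := by
    rw [ht]
    exact genericity_moment_ne_zero hm (by omega) hμ
  have hopen : IsOpen {t | genericity (veroneseSum m d (J t)) ≠ 0} :=
    (continuous_genericity.comp (continuous_veroneseSum.comp J.continuous)).isOpen_preimage _
      isOpen_ne
  obtain ⟨π, e, he, heπ⟩ := exists_openPartialHomeomorph_of_injective_fderiv
    (contDiff_realChart (m := m) (d := d)).contDiffAt (fderiv_realChart_injective hd hJi hJ
      (linearIndependent_of_genericity_ne_zero (by omega) hgt))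
  obtain ⟨ρ, hρ, hball⟩ := Metric.isOpen_iff.1 (hopen.inter e.open_source) t ⟨hgt, he⟩
  have hli : ∀ t' ∈ Metric.ball t ρ, LinearIndependent ℂ (J t') := fun t' ht' =>
    linearIndependent_of_genericity_ne_zero (by omega) (hball ht').1
  have hsub : realChart d J '' Metric.ball t ρ ⊆ realSecantCone m d 5 := by
    rintro _ ⟨t', ht', rfl⟩
    refine ⟨fun h0 => (hball ht').1 ?_, ?_⟩
    · rw [← ofReal_realChart hJ, genericity_ofReal, h0, genericity_zero, Complex.ofReal_zero]
    · rw [ofReal_realChart hJ, secantCone_five (by omega)]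
      exact subset_closure ⟨_, rfl⟩
  refine ⟨realChart d J '' Metric.ball t ρ, ?_, ?_, ?_, ?_⟩
  · exact ((convex_ball t ρ).isConnected ⟨t, Metric.mem_ball_self hρ⟩).image _
      (contDiff_realChart (n := 0)).continuous.continuousOn
  -- The image is a neighbourhood of each of its points in the real locus, hence the trace of the
  -- largest such open set.
  · refine ⟨⋃₀ {O | IsOpen O ∧ O ∩ realSecantCone m d 5 ⊆ realChart d J '' Metric.ball t ρ},
      isOpen_sUnion fun O hO => hO.1, Set.Subset.antisymm (fun p hp => ⟨hsub hp, ?_⟩) ?_⟩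
    · obtain ⟨t', ht', rfl⟩ := hp
      obtain ⟨O, hO, hpO, hOU⟩ := mem_nhdsWithin.1 (image_realChart_mem_nhdsWithin hd hJi hJ
        (hball ht').1 (Metric.isOpen_ball.mem_nhds ht'))
      exact ⟨O, ⟨hO, hOU⟩, hpO⟩
    · rintro p ⟨hp, O, hO, hpO⟩
      exact hO.2 ⟨hpO, hp⟩
  · refine fun p hp => ⟨Set.univ, isOpen_univ, trivial, Metric.ball t ρ, realChart d J,
      Metric.isOpen_ball, contDiff_realChart.contDiffOn,
      fun t' ht' => fderiv_realChart_injective hd hJi hJ (hli t' ht'), ?_, by simp⟩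
    -- On the ball `π ∘ realChart` coincides with the local homeomorphism `e`.
    refine IsEmbedding.of_comp ((contDiff_realChart (n := 0)).continuous.comp
      continuous_subtype_val) π.continuous ?_
    have h1 := e.isOpenEmbedding_restrict.isEmbedding.comp
      (IsEmbedding.inclusion fun t' ht' => (hball ht').2)
    convert h1 using 1
    funext t'
    exact (heπ _).symm
  · rintro _ ⟨t', ht', rfl⟩
    exact hr _ (J t') (hli t' ht') ((hJ _).1 ⟨t', rfl⟩) (ofReal_realChart hJ t')

end Chart

/-! ### The typical ranks -/

theorem mainTheorem6 (m d : ℕ) (hm : 4 ≤ m) (hd : 10 ≤ d) :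
    {r : ℕ | IsTypicalRank m d 5 r} = {5, d + 3, 2 * d + 1} := by
  have hsum : ∀ (p : VeroneseSpace ℝ m d) (x : Fin 5 → Fin (m + 1) → ℂ),
      (fun s => (p s : ℂ)) = veroneseSum m d x →
      (fun s => (p s : ℂ)) = ∑ k, (fun _ => 1 : Fin 5 → ℂ) k • veronese m d (x k) := by
    intro p x h
    simp [h, veroneseSum_eq_sum]
  have h1 : ∀ k : Fin 5, (fun _ => 1 : Fin 5 → ℂ) k ≠ 0 := fun _ => one_ne_zero
  refine Set.Subset.antisymm ?_ ?_
  · rintro r ⟨U, hconn, ⟨O, -, hO⟩, hU, hr⟩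
    have hsub : U ⊆ realSecantCone m d 5 := hO ▸ Set.inter_subset_left
    -- One generic point of `U` already determines the rank.
    obtain ⟨p, hp, hg⟩ := exists_genericity_ne_zero hm hd hU hconn.nonempty hsub
    obtain ⟨r', hr', hrank⟩ := exists_hasRank_of_genericity_ne_zero hd (hsub hp) hg
    rwa [(hr p hp).unique hrank]
  · rintro r (rfl | rfl | rfl)
    · refine isTypicalRank_of_perm (τ := 1) (μ := ![0, 1, 2, 3, 4]) hm hd (by simp) ?_ ?_
        fun p x hx hs h => hasRank_five hd hx h1 (hsum p x h) hs
      · intro a b h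
        fin_cases a <;> fin_cases b <;> first | rfl | norm_num at h
      · intro k
        fin_cases k <;> simp
    · refine isTypicalRank_of_perm (τ := Equiv.swap 0 1) (μ := ![Complex.I, -Complex.I, 2, 3, 4])
        hm hd (by decide) ?_ ?_
        fun p x hx hs h => hasRank_add_three hd hx h1 (hsum p x h) (hs 0) (hs 2) (hs 3) (hs 4)
      · intro a b h
        fin_cases a <;> fin_cases b <;> first | rfl | norm_num [Complex.ext_iff] at h
      · intro k
        fin_cases k <;> simp [Equiv.swap_apply_def]
    · refine isTypicalRank_of_perm (τ := Equiv.swap 0 1 * Equiv.swap 2 3)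
        (μ := ![Complex.I, -Complex.I, 2 * Complex.I, -(2 * Complex.I), 4]) hm hd (by decide) ?_ ?_
        fun p x hx hs h => hasRank_two_mul_add_one hd hx h1 (hsum p x h) (hs 0) (hs 2) (hs 4)
      · intro a b h
        fin_cases a <;> fin_cases b <;> first | rfl | norm_num [Complex.ext_iff] at h
      · intro k
        fin_cases k <;> simp [Equiv.swap_apply_def]
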